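/- Let $h$ and $d$ be integers with $h \geq 1$ and $d \geq 3$, and let $\mathbf{e}_1,\dots,\mathbf{e}_d$ be the unit coordinate vectors of $\mathbb{R}^d$. Put $\mathbf{m} = \mathbf{e}_2+\cdots+\mathbf{e}_{d-1}$, and let $P_{h,d} \subset \mathbb{R}^d$ be the convex hull of the points $$\mathbf{0},\quad \mathbf{e}_d,\quad \mathbf{m},\quad h(\mathbf{m}+\mathbf{e}_d),\quad (h-1)\mathbf{m}+h\mathbf{e}_d,\quad h\mathbf{m}+(h-1)\mathbf{e}_d,$$ $$\mathbf{e}_1+4\mathbf{e}_d,\quad \mathbf{e}_1+5\mathbf{e}_d,\quad \mathbf{e}_1+\mathbf{m},\quad \mathbf{e}_1+\mathbf{m}+\mathbf{e}_d,$$ together with the points $\mathbf{e}_i$ and $\mathbf{e}_i+\mathbf{e}_d$ for $i=2,\dots,d-1$. Let $F_0 = P_{h,d} \cap \{x \in \mathbb{R}^d : x_1 = 0\}$. Then $F_0$ has a regular unimodular triangulation: there are a finite geometric simplicial complex $T$ with underlying space $F_0$ and with all vertices in $\mathbb{Z}^d$, and a height function $\omega$ on $F_0 \cap \mathbb{Z}^d$,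 such that (i) (unimodular) for every simplex of $T$, every integer point in the affine hull of its vertex set is an affine combination of its vertices with integer coefficients; (ii) (regular) a nonempty finite set $s \subset F_0\cap\mathbb{Z}^d$ is the vertex set of a simplex of $T$ if and only if there is an affine function $\varphi:\mathbb{R}^d\to\mathbb{R}$ with $\varphi(a)=\omega(a)$ for $a\in s$ and $\varphi(a)<\omega(a)$ for $a\in (F_0\cap\mathbb{Z}^d)\setminus s$. In particular, $F_0$ is normal: if $A$ denotes the set of points of $\mathbb{Z}^{d+1}$ in the convex hull of $\{(\alpha,1)\in\mathbb{R}^{d+1} : \alpha\in F_0\}$, then $\mathbb{R}_{\geq 0}A\cap\mathbb{Z}A=\mathbb{Z}_{\geq 0}A$. -/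

import Mathlib

open scoped NNReal

/-- The lattice `ℤ^N` inside `ℝ^N`: the points all of whose coordinates are integers. -/
def integerPoints (N : ℕ) : Set (Fin N → ℝ) :=
  {x | ∀ i, ∃ z : ℤ, x i = (z : ℝ)}

section Normality

/-- `P̃ ⊆ ℝ^(N+1)`: the convex hull of the points `(α, 1)` with `α ∈ P`. -/
def homogenization {N : ℕ} (P : Set (Fin N → ℝ)) : Set (Fin (N + 1) → ℝ) :=
  convexHull ℝ ((fun α : Fin N → ℝ => (Fin.snoc (α := fun _ => ℝ) α 1 : Fin (N + 1) → ℝ)) '' P)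

/-- `A_P = P̃ ∩ ℤ^(N+1)`. -/
def latticeConfiguration {N : ℕ} (P : Set (Fin N → ℝ)) : Set (Fin (N + 1) → ℝ) :=
  homogenization P ∩ integerPoints (N + 1)

/-- `P` is normal: `ℝ≥0 A_P ∩ ℤ A_P = ℤ≥0 A_P`. -/
def IsNormalPolytope {N : ℕ} (P : Set (Fin N → ℝ)) : Prop :=
  (Submodule.span ℝ≥0 (latticeConfiguration P) : Set (Fin (N + 1) → ℝ)) ∩
      (AddSubgroup.closure (latticeConfiguration P) : Set (Fin (N + 1) → ℝ)) =
    (AddSubmonoid.closure (latticeConfiguration P) : Set (Fin (N + 1) → ℝ))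

end Normality

section Triangulations

/-- `T` is a triangulation of `P` all of whose vertices are integer points: a finite geometric
simplicial complex with integral vertices and underlying space `P`. -/
structure IsLatticeTriangulation {N : ℕ} (T : Geometry.SimplicialComplex ℝ (Fin N → ℝ))
    (P : Set (Fin N → ℝ)) : Prop where
  finite_faces : T.faces.Finite
  vertices_integral : T.vertices ⊆ integerPoints N
  space_eq : T.space = P

/-- A simplex with integral (affinely independent) vertex set `s` is unimodular when its vertices
affinely generate over `ℤ` all integer points of its affine hull; equivalently, for `v₀ ∈ s`, the
vectors `v - v₀`, `v ∈ s \ {v₀}`, are a `ℤ`-basis of the lattice of integer vectors parallel to the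
affine hull of `s`. -/
def IsUnimodularSimplex {N : ℕ} (s : Finset (Fin N → ℝ)) : Prop :=
  (s : Set (Fin N → ℝ)) ⊆ integerPoints N ∧
    ∀ x ∈ integerPoints N, x ∈ affineSpan ℝ (s : Set (Fin N → ℝ)) →
      ∃ c : (Fin N → ℝ) → ℤ, ∑ v ∈ s, c v = 1 ∧ ∑ v ∈ s, (c v : ℝ) • v = x

/-- All simplices of the complex `T` are unimodular. -/
def IsUnimodularComplex {N : ℕ} (T : Geometry.SimplicialComplex ℝ (Fin N → ℝ)) : Prop :=
  ∀ s ∈ T.faces, IsUnimodularSimplex s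

/-- `T` is the regular triangulation of the integer points of `P` for some heights `ω`: its
simplices are the projections of the lower faces of the convex hull of the lifted points
`(a, ω a)`, `a ∈ P ∩ ℤ^N`. That is, `s` is a simplex exactly when some affine function `φ`
satisfies `φ a = ω a` for `a ∈ s` and `φ a < ω a` for the other `a ∈ P ∩ ℤ^N`. -/
def IsRegularTriangulation {N : ℕ} (T : Geometry.SimplicialComplex ℝ (Fin N → ℝ))
    (P : Set (Fin N → ℝ)) : Prop :=
  ∃ ω : (Fin N → ℝ) → ℝ, ∀ s : Finset (Fin N → ℝ),
    s ∈ T.faces ↔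
      s.Nonempty ∧ (s : Set (Fin N → ℝ)) ⊆ P ∩ integerPoints N ∧
        ∃ φ : (Fin N → ℝ) →ᵃ[ℝ] ℝ,
          (∀ a ∈ s, φ a = ω a) ∧ ∀ a ∈ P ∩ integerPoints N, a ∉ s → φ a < ω a

/-- `P` has a regular unimodular triangulation. -/
def HasRegularUnimodularTriangulation {N : ℕ} (P : Set (Fin N → ℝ)) : Prop :=
  ∃ T : Geometry.SimplicialComplex ℝ (Fin N → ℝ),
    IsLatticeTriangulation T P ∧ IsUnimodularComplex T ∧ IsRegularTriangulation T P

end Triangulations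

section ThePolytope

/-- The unit coordinate vector `e_k` of `ℝ^d`, with the coordinates numbered `1, …, d`. -/
def coordVec (d k : ℕ) : Fin d → ℝ :=
  fun j => if (j : ℕ) + 1 = k then 1 else 0

/-- `e_2 + ⋯ + e_{d-1}`. -/
def middleVec (d : ℕ) : Fin d → ℝ :=
  ∑ k ∈ Finset.Icc 2 (d - 1), coordVec d k

/-- The points `u_1, …, u_10`. -/
def uPoints (h d : ℕ) : Set (Fin d → ℝ) :=
  { 0,
    coordVec d d,
    middleVec d,
    (h : ℝ) • (middleVec d + coordVec d d),
    ((h : ℝ) - 1) • middleVec d + (h : ℝ) • coordVec d d,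
    (h : ℝ) • middleVec d + ((h : ℝ) - 1) • coordVec d d,
    coordVec d 1 + (4 : ℝ) • coordVec d d,
    coordVec d 1 + (5 : ℝ) • coordVec d d,
    coordVec d 1 + middleVec d,
    coordVec d 1 + middleVec d + coordVec d d }

/-- The points `v_i = e_i` and `v_i' = e_i + e_d`, for `i = 2, …, d - 1`. -/
def vPoints (d : ℕ) : Set (Fin d → ℝ) :=
  {x | ∃ i : ℕ, 2 ≤ i ∧ i ≤ d - 1 ∧ (x = coordVec d i ∨ x = coordVec d i + coordVec d d)}

/-- The polytope `P_{h,d}`. -/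
def polytopeP (h d : ℕ) : Set (Fin d → ℝ) :=
  convexHull ℝ (uPoints h d ∪ vPoints d)

/-- `F_0 = P_{h,d} ∩ {x_1 = 0}`; the coordinate `x_1` is the one with index `0` in `Fin d`. -/
def facetZero (h d : ℕ) : Set (Fin d → ℝ) :=
  polytopeP h d ∩ {x | ∀ j : Fin d, (j : ℕ) = 0 → x j = 0}

end ThePolytope

/-! ### Affine functionals and integral dual systems -/

section Certificates

variable {N : ℕ}

/-! Write `m` for the middle vector. Dropping the last coordinate sends the integer points of the
facet onto a base configuration: the multiples `k m` with `0 ≤ k ≤ h`, together with the unit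
vectors `e_i` (when there is only one, it is `m` itself). The fibres are runs of consecutive
integers, from `max (k - 1) 0` to `min (k + 1) h` over `k m`, and `{0, 1}` over a unit vector
distinct from `m`. The base has a regular unimodular triangulation whose facets are spanned by `k
m`, `(k + 1) m` and all `e_i` but one.

Such a bundle of segments is triangulated by staircases. Give the base points distinct labels `0 ≤ ε
b < L` and lift `b + y e` to `M β(b) + L y (y - 1) + 2 ε(b) y`, whose increment from `y` to `y + 1`
is `2 (L y + ε b)`. The staircase of level `θ` takes over `b` the first `y` of the fibre with `θ ≤ L
y + ε b`, or the top if there is none. The numbers `L y + ε b` are pairwise distinct, so between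
levels `θ` and `θ + 1` at most one base point moves, by one unit. Over a base facet, the points of
two consecutive staircases therefore span a unimodular simplex, and for large `M` an affine function
of slope `2 θ` along `e` supports it from below. As `θ` grows, these simplices sweep out the
polytope.

The rest is a general criterion. If the barycentric coordinates of each cell extend to integral
affine functionals, the cells are unimodular simplices. If they are moreover lower faces of one
lifting and cover the polytope, every lower face lies in a cell, so the lower faces form the
required complex (`hasRegularUnimodularTriangulation_of_cover`). The same functionals show that
lattice points of the cone have natural number coefficients (`isNormalPolytope_of_cover`). For the
facet, the fibres and the covering both follow from the six inequalities of `IsFrame.inequalities`.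
-/

theorem AffineMap.sum_mul_apply {ι : Type*} (φ : (Fin N → ℝ) →ᵃ[ℝ] ℝ) (s : Finset ι) (w : ι → ℝ)
    (v : ι → Fin N → ℝ) :
    ∑ i ∈ s, w i * φ (v i) = φ.linear (∑ i ∈ s, w i • v i) + (∑ i ∈ s, w i) * φ 0 := by
  rw [map_sum, Finset.sum_mul, ← Finset.sum_add_distrib]
  refine Finset.sum_congr rfl fun i _ => ?_
  rw [map_smul, smul_eq_mul, ← mul_add]
  congr 1
  exact congrFun φ.decomp (v i)

theorem AffineMap.apply_sum_smul {ι : Type*} (φ : (Fin N → ℝ) →ᵃ[ℝ] ℝ) (s : Finset ι) (w : ι → ℝ)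
    (v : ι → Fin N → ℝ) (hw : ∑ i ∈ s, w i = 1) :
    φ (∑ i ∈ s, w i • v i) = ∑ i ∈ s, w i * φ (v i) := by
  rw [AffineMap.sum_mul_apply, hw, one_mul]
  exact congrFun φ.decomp _

theorem AffineMap.sum_apply_real {ι : Type*} (s : Finset ι) (f : ι → (Fin N → ℝ) →ᵃ[ℝ] ℝ)
    (x : Fin N → ℝ) : (∑ i ∈ s, f i) x = ∑ i ∈ s, f i x := by
  classical
  induction s using Finset.induction_on with
  | empty => simp
  | insert a s ha ih => rw [Finset.sum_insert ha, Finset.sum_insert ha, ← ih]; rfl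

/-- An affine functional taking integer values at the integer points. -/
def AffineMap.IsIntegral (l : (Fin N → ℝ) →ᵃ[ℝ] ℝ) : Prop :=
  ∀ x ∈ integerPoints N, ∃ z : ℤ, l x = z

/-- The points of `s` have barycentric coordinates that extend to integral affine functionals. -/
def HasIntegralDual (s : Finset (Fin N → ℝ)) : Prop :=
  ∀ v ∈ s, ∃ l : (Fin N → ℝ) →ᵃ[ℝ] ℝ, l.IsIntegral ∧ l v = 1 ∧ ∀ w ∈ s, w ≠ v → l w = 0

theorem HasIntegralDual.mono {s t : Finset (Fin N → ℝ)} (ht : HasIntegralDual t) (hst : s ⊆ t) :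
    HasIntegralDual s := fun v hv =>
  let ⟨l, h1, h2, h3⟩ := ht v (hst hv)
  ⟨l, h1, h2, fun w hw => h3 w (hst hw)⟩

theorem HasIntegralDual.affineIndependent {s : Finset (Fin N → ℝ)} (hs : HasIntegralDual s) :
    AffineIndependent ℝ ((↑) : s → Fin N → ℝ) := by
  classical
  rw [affineIndependent_iff]
  intro t w hw0 hw i hi
  obtain ⟨l, -, h1, h2⟩ := hs i i.2
  have := AffineMap.sum_mul_apply l t w (fun j => (j : Fin N → ℝ))
  rw [hw, hw0, map_zero, zero_mul, add_zero, Finset.sum_eq_single i] at this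
  · simpa [h1] using this
  · intro j _ hj
    rw [h2 j j.2 (fun h => hj (Subtype.ext h)), mul_zero]
  · exact fun h => absurd hi h

/-- On the affine span the dual functionals are the barycentric coordinates, and they are integers
at integer points. -/
theorem HasIntegralDual.isUnimodularSimplex {s : Finset (Fin N → ℝ)} (hs : HasIntegralDual s)
    (hint : (s : Set (Fin N → ℝ)) ⊆ integerPoints N) : IsUnimodularSimplex s := by
  classical
  refine ⟨hint, fun x hx hxs => ?_⟩
  choose! l hl h1 h2 using hs
  have key : ∑ v ∈ s, l v x = 1 ∧ ∑ v ∈ s, l v x • v = x := by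
    refine affineSpan_induction (p := fun x => ∑ v ∈ s, l v x = 1 ∧ ∑ v ∈ s, l v x • v = x) hxs
      (fun y hy => ?_) (fun c u v w hu hv hw => ?_)
    · have h : ∀ v ∈ s, v ≠ y → l v y = 0 := fun v hv hvy => h2 v hv y hy (Ne.symm hvy)
      constructor
      · rw [Finset.sum_eq_single y (fun v hv hvy => h v hv hvy) (fun h => absurd hy h), h1 y hy]
      · rw [Finset.sum_eq_single y (fun v hv hvy => by rw [h v hv hvy, zero_smul])
          (fun h => absurd hy h), h1 y hy, one_smul]
    · have e : ∀ a, l a (c • (u -ᵥ v) +ᵥ w) = c * (l a u - l a v) + l a w := by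
        intro a
        rw [AffineMap.map_vadd, map_smul, AffineMap.linearMap_vsub]; rfl
      simp only [e, Finset.sum_add_distrib, ← Finset.mul_sum, Finset.sum_sub_distrib, add_smul,
        mul_smul, sub_smul, ← Finset.smul_sum, hu.1, hu.2, hv.1, hv.2, hw.1, hw.2]
      exact ⟨by ring, rfl⟩
  have hz : ∀ v ∈ s, ∃ z : ℤ, l v x = z := fun v hv => hl v hv x hx
  choose! c hc using hz
  refine ⟨c, ?_, ?_⟩
  · have := key.1
    rw [Finset.sum_congr rfl hc] at this
    exact_mod_cast this
  · exact (Finset.sum_congr rfl fun v hv => by rw [← hc v hv]).trans key.2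

/-! ### Lower faces of a lifted configuration -/

/-- `s ⊆ A` is the set of points of `A` on a supporting hyperplane of the lifted configuration. -/
def IsLowerFace (A : Set (Fin N → ℝ)) (ω : (Fin N → ℝ) → ℝ) (s : Finset (Fin N → ℝ)) : Prop :=
  (s : Set (Fin N → ℝ)) ⊆ A ∧ ∃ φ : (Fin N → ℝ) →ᵃ[ℝ] ℝ,
    (∀ a ∈ s, φ a = ω a) ∧ ∀ a ∈ A, a ∉ s → φ a < ω a

/-- Let `φ` and `ψ` support `s` and `t`. Both are at most `ω` on `A`, so at a common point of the
two hulls each is at most the other. Equality then holds term by term: `ψ a = φ a = ω a` at every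
`a` of nonzero weight, which forces `a ∈ t`. -/
theorem IsLowerFace.mem_of_sum_mem {A : Set (Fin N → ℝ)} {ω : (Fin N → ℝ) → ℝ}
    {s t : Finset (Fin N → ℝ)} (hs : IsLowerFace A ω s) (ht : IsLowerFace A ω t)
    {w : (Fin N → ℝ) → ℝ} (hw : ∀ a ∈ s, 0 ≤ w a) (hw1 : ∑ a ∈ s, w a = 1)
    (hx : ∑ a ∈ s, w a • a ∈ convexHull ℝ (t : Set (Fin N → ℝ))) {a : Fin N → ℝ} (ha : a ∈ s)
    (hwa : w a ≠ 0) : a ∈ t := by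
  obtain ⟨hsA, φ, hφ, hφ'⟩ := hs
  obtain ⟨htA, ψ, hψ, hψ'⟩ := ht
  have hφle : ∀ a ∈ A, φ a ≤ ω a := fun a ha => by
    by_cases h : a ∈ s
    · exact (hφ a h).le
    · exact (hφ' a ha h).le
  have hψle : ∀ a ∈ A, ψ a ≤ ω a := fun a ha => by
    by_cases h : a ∈ t
    · exact (hψ a h).le
    · exact (hψ' a ha h).le
  obtain ⟨u, hu, hu1, hux⟩ := Finset.mem_convexHull'.1 hx
  have e1 := φ.apply_sum_smul s w id hw1
  have e2 := ψ.apply_sum_smul s w id hw1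
  have e3 := φ.apply_sum_smul t u id hu1
  have e4 := ψ.apply_sum_smul t u id hu1
  simp only [id] at e1 e2 e3 e4
  rw [hux] at e3 e4
  have l1 : φ (∑ a ∈ s, w a • a) ≤ ψ (∑ a ∈ s, w a • a) := by
    rw [e3, e4]
    refine Finset.sum_le_sum fun b hb => mul_le_mul_of_nonneg_left ?_ (hu b hb)
    rw [hψ b hb]
    exact hφle b (htA hb)
  rw [e1, e2] at l1
  have l2 : ∀ b ∈ s, w b * ψ b ≤ w b * φ b := fun b hb => by
    refine mul_le_mul_of_nonneg_left ?_ (hw b hb)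
    rw [hφ b hb]
    exact hψle b (hsA hb)
  have l3 := (Finset.sum_eq_sum_iff_of_le l2).1 (le_antisymm (Finset.sum_le_sum l2) l1) a ha
  by_contra hat
  have := mul_left_cancel₀ hwa l3
  rw [hφ a ha] at this
  exact absurd this (hψ' a (hsA ha) hat).ne

theorem IsLowerFace.inter_subset {A : Set (Fin N → ℝ)} {ω : (Fin N → ℝ) → ℝ}
    {s t : Finset (Fin N → ℝ)} (hs : IsLowerFace A ω s) (ht : IsLowerFace A ω t) :
    convexHull ℝ (s : Set (Fin N → ℝ)) ∩ convexHull ℝ (t : Set (Fin N → ℝ)) ⊆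
      convexHull ℝ ((s : Set (Fin N → ℝ)) ∩ t) := by
  classical
  rintro x ⟨hxs, hxt⟩
  obtain ⟨w, hw, hw1, rfl⟩ := Finset.mem_convexHull'.1 hxs
  have h0 : ∀ a ∈ s, a ∉ s ∩ t → w a = 0 := fun a ha hat => by
    by_contra h
    exact hat (Finset.mem_inter.2 ⟨ha, hs.mem_of_sum_mem ht hw hw1 hxt ha h⟩)
  rw [← Finset.coe_inter, Finset.mem_convexHull']
  refine ⟨w, fun y hy => hw y (Finset.mem_inter.1 hy).1, ?_, ?_⟩
  · rw [← hw1]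
    exact Finset.sum_subset Finset.inter_subset_left h0
  · exact Finset.sum_subset Finset.inter_subset_left fun a ha hat => by rw [h0 a ha hat, zero_smul]

/-- The centroid of `s` lies in some cell and gives every point of `s` a positive weight. -/
theorem IsLowerFace.subset_of_cover {A P : Set (Fin N → ℝ)} {ω : (Fin N → ℝ) → ℝ}
    {C : Set (Finset (Fin N → ℝ))} (hP : Convex ℝ P) (hA : A ⊆ P) (hC : ∀ t ∈ C, IsLowerFace A ω t)
    (hcov : ∀ x ∈ P, ∃ t ∈ C, x ∈ convexHull ℝ (t : Set (Fin N → ℝ)))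
    {s : Finset (Fin N → ℝ)} (hs : IsLowerFace A ω s) (hne : s.Nonempty) : ∃ t ∈ C, s ⊆ t := by
  have hc : (0 : ℝ) < s.card := by exact_mod_cast hne.card_pos
  have hw1 : ∑ _a ∈ s, (s.card : ℝ)⁻¹ = 1 := by
    rw [Finset.sum_const, nsmul_eq_mul, mul_inv_cancel₀ hc.ne']
  have hx : ∑ a ∈ s, (s.card : ℝ)⁻¹ • a ∈ P :=
    hP.sum_mem (fun _ _ => by positivity) hw1 fun a ha => hA (hs.1 ha)
  obtain ⟨t, ht, hxt⟩ := hcov _ hx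
  exact ⟨t, ht, fun a ha => hs.mem_of_sum_mem (hC t ht) (w := fun _ => (s.card : ℝ)⁻¹)
    (fun _ _ => by positivity) hw1 hxt ha (by positivity)⟩

/-- The sum `ψ` of the dual functionals of `t \ s` is `0` on `s` and `1` on `t \ s`. Subtracting a
small positive multiple of it from the support of `t` releases exactly `t \ s`; as `A` is finite,
the strict inequalities off `t` survive. -/
theorem IsLowerFace.mono {A : Set (Fin N → ℝ)} {ω : (Fin N → ℝ) → ℝ} (hA : A.Finite)
    {s t : Finset (Fin N → ℝ)} (ht : IsLowerFace A ω t) (hd : HasIntegralDual t) (hst : s ⊆ t) :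
    IsLowerFace A ω s := by
  classical
  obtain ⟨htA, φ, hφ, hφ'⟩ := ht
  choose! l hl h1 h2 using hd
  set ψ : (Fin N → ℝ) →ᵃ[ℝ] ℝ := ∑ v ∈ t \ s, l v with hψ
  have hψs : ∀ a ∈ s, ψ a = 0 := fun a ha => by
    rw [hψ, AffineMap.sum_apply_real]
    refine Finset.sum_eq_zero fun v hv => ?_
    rw [Finset.mem_sdiff] at hv
    exact h2 v hv.1 a (hst ha) (fun h => hv.2 (h ▸ ha))
  have hψt : ∀ a ∈ t, a ∉ s → ψ a = 1 := fun a ha has => by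
    rw [hψ, AffineMap.sum_apply_real, Finset.sum_eq_single a, h1 a ha]
    · exact fun v hv hva => h2 v (Finset.mem_sdiff.1 hv).1 a ha (Ne.symm hva)
    · exact fun h => absurd (Finset.mem_sdiff.2 ⟨ha, has⟩) h
  have hev : ∀ᶠ ε : ℝ in nhdsWithin 0 (Set.Ioi 0), ∀ a ∈ A, a ∉ t → φ a - ε * ψ a < ω a := by
    rw [Filter.eventually_all_finite hA]
    intro a ha
    by_cases hat : a ∈ t
    · simp [hat]
    have hc : Continuous fun ε : ℝ => φ a - ε * ψ a := by fun_prop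
    have := hc.tendsto 0
    simp only [zero_mul, sub_zero] at this
    filter_upwards [nhdsWithin_le_nhds (this.eventually_lt_const (hφ' a ha hat))] with ε hε _
    exact hε
  obtain ⟨ε, hε, hε0⟩ := (hev.and self_mem_nhdsWithin).exists
  refine ⟨fun a ha => htA (hst ha), φ - ε • ψ, fun a ha => ?_, fun a ha has => ?_⟩
  · simp [hψs a ha, hφ a (hst ha)]
  · by_cases hat : a ∈ t
    · have : (0 : ℝ) < ε := hε0
      simp [hψt a hat has, hφ a hat, this]
    · simpa using hε a ha hat

/-- A family of lower faces with integral dual systems that covers `P` generates a regular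
unimodular triangulation. -/
theorem hasRegularUnimodularTriangulation_of_cover {P : Set (Fin N → ℝ)} (hP : Convex ℝ P)
    (hfin : (P ∩ integerPoints N).Finite) (ω : (Fin N → ℝ) → ℝ) {C : Set (Finset (Fin N → ℝ))}
    (hC : ∀ t ∈ C, IsLowerFace (P ∩ integerPoints N) ω t) (hd : ∀ t ∈ C, HasIntegralDual t)
    (hcov : ∀ x ∈ P, ∃ t ∈ C, x ∈ convexHull ℝ (t : Set (Fin N → ℝ))) :
    HasRegularUnimodularTriangulation P := by
  -- Taking all nonempty lower faces as simplices makes regularity hold by definition; the covering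
  -- cells serve to make every lower face unimodular.
  have hcell : ∀ s, s.Nonempty → IsLowerFace (P ∩ integerPoints N) ω s → HasIntegralDual s :=
    fun s hne hs =>
      let ⟨t, ht, hst⟩ := hs.subset_of_cover hP Set.inter_subset_left hC hcov hne
      (hd t ht).mono hst
  let T : Geometry.SimplicialComplex ℝ (Fin N → ℝ) :=
    { faces := {s | s.Nonempty ∧ IsLowerFace (P ∩ integerPoints N) ω s}
      isRelLowerSet_faces := fun s hs =>
        ⟨hs.1, fun t hts hne => ⟨hne, hs.2.mono hfin (hcell s hs.1 hs.2) hts⟩⟩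
      indep := fun hs => (hcell _ hs.1 hs.2).affineIndependent
      inter_subset_convexHull := fun hs ht => hs.2.inter_subset ht.2 }
  have hmem : ∀ s, s ∈ T.faces ↔ s.Nonempty ∧ IsLowerFace (P ∩ integerPoints N) ω s :=
    fun s => Iff.rfl
  refine ⟨T, ⟨?_, ?_, ?_⟩, ?_, ω, fun s => hmem s⟩
  · refine Set.Finite.subset (hfin.toFinset.powerset.finite_toSet) fun s hs => ?_
    rw [Finset.mem_coe, Finset.mem_powerset]
    exact fun a ha => hfin.mem_toFinset.2 (((hmem s).1 hs).2.1 ha)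
  · intro x hx
    exact (((hmem _).1 hx).2.1 (Finset.mem_coe.2 (Finset.mem_singleton_self x))).2
  · ext x
    rw [Geometry.SimplicialComplex.mem_space_iff]
    constructor
    · rintro ⟨s, hs, hx⟩
      exact convexHull_min (fun a ha => (hs.2.1 ha).1) hP hx
    · intro hx
      obtain ⟨t, ht, hxt⟩ := hcov x hx
      exact ⟨t, ⟨by simpa using convexHull_nonempty_iff.1 ⟨x, hxt⟩, hC t ht⟩, hxt⟩
  · exact fun s hs => (hcell s hs.1 hs.2).isUnimodularSimplex fun a ha => (hs.2.1 ha).2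

/-! ### Normality -/

/-- The integer points as an additive subgroup. -/
def integerSubgroup (N : ℕ) : AddSubgroup (Fin N → ℝ) where
  carrier := integerPoints N
  zero_mem' := fun _ => ⟨0, by simp⟩
  add_mem' := fun {a b} ha hb i => by
    obtain ⟨z, hz⟩ := ha i
    obtain ⟨y, hy⟩ := hb i
    exact ⟨z + y, by simp [hz, hy]⟩
  neg_mem' := fun {a} ha i => by
    obtain ⟨z, hz⟩ := ha i
    exact ⟨-z, by simp [hz]⟩

theorem homogenization_of_convex {P : Set (Fin N → ℝ)} (hP : Convex ℝ P) {z : Fin (N + 1) → ℝ}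
    (hz : z ∈ homogenization P) :
    ∃ p ∈ P, z = (Fin.snoc (α := fun _ => ℝ) p 1 : Fin (N + 1) → ℝ) := by
  refine convexHull_min (t := {z | ∃ p ∈ P,
    z = (Fin.snoc (α := fun _ => ℝ) p 1 : Fin (N + 1) → ℝ)}) ?_ ?_ hz
  · rintro _ ⟨p, hp, rfl⟩
    exact ⟨p, hp, rfl⟩
  · rintro _ ⟨p, hp, rfl⟩ _ ⟨q, hq, rfl⟩ a b ha hb hab
    refine ⟨a • p + b • q, hP hp hq ha hb hab, ?_⟩
    ext i
    refine Fin.lastCases ?_ (fun j => ?_) i <;> simp [hab]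

theorem mem_cone_latticeConfiguration {P : Set (Fin N → ℝ)} (hP : Convex ℝ P)
    {x : Fin (N + 1) → ℝ} (hx : x ∈ Submodule.span ℝ≥0 (latticeConfiguration P)) :
    x = 0 ∨ ∃ c : ℝ, 0 < c ∧ ∃ p ∈ P,
      x = c • (Fin.snoc (α := fun _ => ℝ) p 1 : Fin (N + 1) → ℝ) := by
  induction hx using Submodule.span_induction with
  | mem x hx =>
    obtain ⟨p, hp, h⟩ := homogenization_of_convex hP hx.1
    exact Or.inr ⟨1, one_pos, p, hp, by rw [one_smul, h]⟩
  | zero => exact Or.inl rfl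
  | add x y _ _ hx hy =>
    rcases hx with rfl | ⟨c, hc, p, hp, rfl⟩
    · simpa using hy
    rcases hy with rfl | ⟨b, hb, q, hq, rfl⟩
    · exact Or.inr ⟨c, hc, p, hp, add_zero _⟩
    have hcb : 0 < c + b := add_pos hc hb
    refine Or.inr ⟨c + b, hcb, (c / (c + b)) • p + (b / (c + b)) • q,
      hP hp hq (by positivity) (by positivity) (by field_simp), ?_⟩
    ext i
    refine Fin.lastCases ?_ (fun j => ?_) i
    · simp
    · simp
      field_simp
  | smul r x _ hx =>
    rcases hx with rfl | ⟨c, hc, p, hp, rfl⟩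
    · exact Or.inl (smul_zero _)
    rcases eq_or_ne r 0 with rfl | hr
    · exact Or.inl (zero_smul _ _)
    · refine Or.inr ⟨(r : ℝ) * c, mul_pos (NNReal.coe_pos.2 (pos_iff_ne_zero.2 hr)) hc, p, hp, ?_⟩
      rw [mul_smul]
      rfl

/-- A convex set covered by integral simplices with integral dual systems is normal. -/
theorem isNormalPolytope_of_cover {P : Set (Fin N → ℝ)} (hP : Convex ℝ P)
    {C : Set (Finset (Fin N → ℝ))}
    (hC : ∀ t ∈ C, (t : Set (Fin N → ℝ)) ⊆ P ∩ integerPoints N) (hd : ∀ t ∈ C, HasIntegralDual t)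
    (hcov : ∀ x ∈ P, ∃ t ∈ C, x ∈ convexHull ℝ (t : Set (Fin N → ℝ))) :
    IsNormalPolytope P := by
  classical
  refine Set.Subset.antisymm ?_ ?_
  · rintro x ⟨hx, hxg⟩
    have hxi : x ∈ integerPoints (N + 1) :=
      (AddSubgroup.closure_le (integerSubgroup (N + 1))).2 (fun y hy => hy.2) hxg
    rcases mem_cone_latticeConfiguration hP hx with rfl | ⟨c, hc, p, hp, rfl⟩
    · exact zero_mem _
    obtain ⟨t, ht, hpt⟩ := hcov p hp
    obtain ⟨w, hw, hw1, rfl⟩ := Finset.mem_convexHull'.1 hpt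
    obtain ⟨k, hk⟩ := hxi (Fin.last N)
    have hk' : c = k := by simpa using hk
    have hcp : c • ∑ v ∈ t, w v • v ∈ integerPoints N := fun i => by
      obtain ⟨z, hz⟩ := hxi i.castSucc
      exact ⟨z, by simpa using hz⟩
    -- Since `l` is affine with `l p = w v` at `p = ∑ v ∈ t, w v • v`, one has `c * w v = l (c p) +
    -- (c - 1) * l 0`. This is an integer, because `c` is the last coordinate of a lattice point.
    have hcoef : ∀ v ∈ t, ∃ n : ℕ, c * w v = n := by
      intro v hv
      obtain ⟨l, hl, h1, h2⟩ := hd t ht v hv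
      obtain ⟨z, hz⟩ := hl _ hcp
      obtain ⟨y, hy⟩ := hl 0 (integerSubgroup N).zero_mem
      have e1 := l.apply_sum_smul t w id hw1
      simp only [id] at e1
      rw [Finset.sum_eq_single (f := fun x => w x * l x) v
        (fun b hb hbv => by rw [h2 b hb hbv, mul_zero])
        (fun h => absurd hv h), h1, mul_one] at e1
      have e2 := congrFun l.decomp (c • ∑ v ∈ t, w v • v)
      have e3 := congrFun l.decomp (∑ v ∈ t, w v • v)
      simp only [Pi.add_apply, map_smul, smul_eq_mul] at e2 e3
      have e4 : c * w v = ((z + (k - 1) * y : ℤ) : ℝ) := by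
        push_cast
        rw [← hz, ← hy, e2, ← e1, e3, ← hk']
        ring
      have h0 : 0 ≤ z + (k - 1) * y := by
        have : (0 : ℝ) ≤ ((z + (k - 1) * y : ℤ) : ℝ) := e4 ▸ mul_nonneg hc.le (hw v hv)
        exact_mod_cast this
      obtain ⟨n, hn⟩ := Int.eq_ofNat_of_zero_le h0
      exact ⟨n, by rw [e4, hn]; simp⟩
    choose! n hn using hcoef
    have hsum : c • (Fin.snoc (α := fun _ => ℝ) (∑ v ∈ t, w v • v) 1 : Fin (N + 1) → ℝ) =
        ∑ v ∈ t, n v • (Fin.snoc (α := fun _ => ℝ) v 1 : Fin (N + 1) → ℝ) := by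
      ext i
      refine Fin.lastCases ?_ (fun j => ?_) i
      · simp only [Pi.smul_apply, Fin.snoc_last, Finset.sum_apply, smul_eq_mul, nsmul_eq_mul,
          Pi.mul_apply, Pi.natCast_apply, mul_one]
        rw [← Finset.sum_congr rfl hn, ← Finset.mul_sum, hw1, mul_one]
      · simp only [Pi.smul_apply, Fin.snoc_castSucc, Finset.sum_apply, smul_eq_mul, nsmul_eq_mul]
        rw [Finset.mul_sum]
        exact Finset.sum_congr rfl fun v hv => by simp [← hn v hv, mul_assoc]
    rw [hsum]
    suffices hmem : ∀ v ∈ t, (Fin.snoc (α := fun _ => ℝ) v 1 : Fin (N + 1) → ℝ) ∈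
        latticeConfiguration P from
      sum_mem fun v hv => nsmul_mem (AddSubmonoid.subset_closure (hmem v hv)) _
    refine fun v hv => ⟨?_, ?_⟩
    · exact subset_convexHull ℝ _ ⟨v, (hC t ht hv).1, rfl⟩
    · intro i
      refine Fin.lastCases ⟨1, by simp⟩ (fun j => ?_) i
      obtain ⟨z, hz⟩ := (hC t ht hv).2 j
      exact ⟨z, by simpa using hz⟩
  · refine fun x hx => ⟨?_, ?_⟩
    · exact (AddSubmonoid.closure_le (S := (Submodule.span ℝ≥0
        (latticeConfiguration P)).toAddSubmonoid)).2 Submodule.subset_span hx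
    · exact (AddSubmonoid.closure_le (S := (AddSubgroup.closure
        (latticeConfiguration P)).toAddSubmonoid)).2 AddSubgroup.subset_closure hx

end Certificates

/-! ### Staircases -/

section Staircase

/-- The least `y ∈ [lo, hi]` with `θ ≤ L * y + ε`, or `hi` if there is none. -/
def stepHeight (L ε lo hi θ : ℤ) : ℤ := max lo (min hi (-((ε - θ) / L)))

variable {L ε lo hi θ : ℤ}

theorem le_stepHeight : lo ≤ stepHeight L ε lo hi θ := le_max_left _ _

theorem stepHeight_le (h : lo ≤ hi) : stepHeight L ε lo hi θ ≤ hi :=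
  max_le h (min_le_left _ _)

/-- With floor division, `-((ε - θ) / L)` is the ceiling of `(θ - ε) / L`, the least integer `y`
with `θ ≤ L * y + ε`. -/
theorem stepHeight_eq_hi_or (hL : 0 < L) :
    hi ≤ stepHeight L ε lo hi θ ∨ θ ≤ L * stepHeight L ε lo hi θ + ε := by
  have h1 := Int.mul_ediv_add_emod (ε - θ) L
  have h2 := Int.emod_nonneg (ε - θ) hL.ne'
  have h4 : -((ε - θ) / L) ≤ stepHeight L ε lo hi θ ∨ hi ≤ stepHeight L ε lo hi θ := by
    unfold stepHeight; omega
  rcases h4 with h4 | h4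
  · right
    have := mul_le_mul_of_nonneg_left h4 hL.le
    linarith
  · exact Or.inl h4

theorem stepHeight_eq_lo_or (hL : 0 < L) :
    stepHeight L ε lo hi θ ≤ lo ∨ L * (stepHeight L ε lo hi θ - 1) + ε < θ := by
  have h1 := Int.mul_ediv_add_emod (ε - θ) L
  have h2 := Int.emod_lt_of_pos (ε - θ) hL
  have h4 : stepHeight L ε lo hi θ ≤ -((ε - θ) / L) ∨ stepHeight L ε lo hi θ ≤ lo := by
    unfold stepHeight; omega
  rcases h4 with h4 | h4
  · right
    have := mul_le_mul_of_nonneg_left h4 hL.le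
    linarith
  · exact Or.inl h4

theorem stepHeight_le_succ (hL : 0 < L) (h : lo ≤ hi) :
    stepHeight L ε lo hi θ ≤ stepHeight L ε lo hi (θ + 1) := by
  by_contra! hlt
  have h1 := le_stepHeight (L := L) (ε := ε) (lo := lo) (hi := hi) (θ := θ + 1)
  have h2 := stepHeight_le (L := L) (ε := ε) (θ := θ) h
  have h3 := (stepHeight_eq_hi_or (ε := ε) (lo := lo) (hi := hi) (θ := θ + 1) hL).resolve_left
    (by omega)
  have h4 := (stepHeight_eq_lo_or (ε := ε) (lo := lo) (hi := hi) (θ := θ) hL).resolve_left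
    (by omega)
  have := mul_le_mul_of_nonneg_left (Int.le_sub_one_of_lt hlt) hL.le
  linarith

theorem stepHeight_succ_le (hL : 0 < L) (h : lo ≤ hi) :
    stepHeight L ε lo hi (θ + 1) ≤ stepHeight L ε lo hi θ + 1 := by
  by_contra! hlt
  have h1 := le_stepHeight (L := L) (ε := ε) (lo := lo) (hi := hi) (θ := θ)
  have h2 := stepHeight_le (L := L) (ε := ε) (θ := θ + 1) h
  have h3 := (stepHeight_eq_hi_or (ε := ε) (lo := lo) (hi := hi) (θ := θ) hL).resolve_left
    (by omega)
  have h4 := (stepHeight_eq_lo_or (ε := ε) (lo := lo) (hi := hi) (θ := θ + 1) hL).resolve_left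
    (by omega)
  have := mul_le_mul_of_nonneg_left
    (show stepHeight L ε lo hi θ + 1 ≤ stepHeight L ε lo hi (θ + 1) - 1 by omega) hL.le
  linarith

/-- The old height satisfies the condition for `θ` and fails it for `θ + 1`, so equality holds
there. -/
theorem eq_of_stepHeight_succ_ne (hL : 0 < L) (h : lo ≤ hi)
    (hne : stepHeight L ε lo hi (θ + 1) ≠ stepHeight L ε lo hi θ) :
    stepHeight L ε lo hi (θ + 1) = stepHeight L ε lo hi θ + 1 ∧
      L * stepHeight L ε lo hi θ + ε = θ := by
  have e1 := stepHeight_le_succ (ε := ε) (θ := θ) hL h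
  have e2 := stepHeight_succ_le (ε := ε) (θ := θ) hL h
  have e : stepHeight L ε lo hi (θ + 1) = stepHeight L ε lo hi θ + 1 := by omega
  have h1 := le_stepHeight (L := L) (ε := ε) (lo := lo) (hi := hi) (θ := θ)
  have h2 := stepHeight_le (L := L) (ε := ε) (θ := θ + 1) h
  have h3 := (stepHeight_eq_hi_or (ε := ε) (lo := lo) (hi := hi) (θ := θ) hL).resolve_left
    (by omega)
  have h4 := (stepHeight_eq_lo_or (ε := ε) (lo := lo) (hi := hi) (θ := θ + 1) hL).resolve_left
    (by omega)
  rw [e, add_sub_cancel_right] at h4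
  exact ⟨e, by omega⟩

theorem stepHeight_eq_lo (hL : 0 < L) (h : θ ≤ L * lo + ε) : stepHeight L ε lo hi θ = lo := by
  refine le_antisymm ?_ le_stepHeight
  rcases stepHeight_eq_lo_or (ε := ε) (lo := lo) (hi := hi) (θ := θ) hL with h1 | h1
  · exact h1
  · by_contra! h2
    have := mul_le_mul_of_nonneg_left (Int.le_sub_one_of_lt h2) hL.le
    linarith

theorem stepHeight_eq_hi (hL : 0 < L) (hle : lo ≤ hi) (h : L * hi + ε < θ) :
    stepHeight L ε lo hi θ = hi := by
  refine le_antisymm (stepHeight_le hle) ?_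
  rcases stepHeight_eq_hi_or (ε := ε) (lo := lo) (hi := hi) (θ := θ) hL with h1 | h1
  · exact h1
  · have := mul_le_mul_of_nonneg_left (stepHeight_le (L := L) (ε := ε) (θ := θ) hle) hL.le
    linarith

/-- A discrete convex function whose difference at `y` is `2 * (L * y + ε)`. -/
def stepEnergy (L ε y : ℤ) : ℤ := L * y * (y - 1) + 2 * ε * y

/-- The increments of the energy minus `2 * θ * y` are `2 * (L * y + ε - θ)`, which increase with
`y`. The minimum is thus reached at the first `y` with nonnegative increment, and also at the next
one when that increment is zero. -/
theorem stepEnergy_stepHeight_le (hL : 0 < L) {y : ℤ} (h1 : lo ≤ y) (h2 : y ≤ hi) :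
    stepEnergy L ε (stepHeight L ε lo hi θ) - 2 * θ * stepHeight L ε lo hi θ ≤
      stepEnergy L ε y - 2 * θ * y ∧
    (stepEnergy L ε (stepHeight L ε lo hi θ) - 2 * θ * stepHeight L ε lo hi θ =
      stepEnergy L ε y - 2 * θ * y →
      y = stepHeight L ε lo hi θ ∨ y = stepHeight L ε lo hi (θ + 1)) := by
  have h3 := stepHeight_eq_hi_or (ε := ε) (lo := lo) (hi := hi) (θ := θ) hL
  have h4 := stepHeight_eq_lo_or (ε := ε) (lo := lo) (hi := hi) (θ := θ) hL
  have h5 := stepHeight_eq_hi_or (ε := ε) (lo := lo) (hi := hi) (θ := θ + 1) hL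
  have h6 := stepHeight_le_succ (ε := ε) (θ := θ) hL (h1.trans h2)
  have h7 := stepHeight_succ_le (ε := ε) (θ := θ) hL (h1.trans h2)
  set f := stepHeight L ε lo hi θ
  have key : stepEnergy L ε y - 2 * θ * y - (stepEnergy L ε f - 2 * θ * f) =
      (y - f) * (L * (y - f - 1) + 2 * (L * f + ε - θ)) := by
    unfold stepEnergy; ring
  rcases lt_trichotomy y f with hlt | heq | hgt
  · have h8 := h4.resolve_left (by omega)
    have h9 : 0 < (f - y) * (L * (f - y - 1) + 2 * (θ - (L * (f - 1) + ε))) :=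
      mul_pos (by omega) (by
        have := mul_nonneg hL.le (show 0 ≤ f - y - 1 by omega)
        linarith)
    have h10 : (y - f) * (L * (y - f - 1) + 2 * (L * f + ε - θ)) =
      (f - y) * (L * (f - y - 1) + 2 * (θ - (L * (f - 1) + ε))) := by ring
    rw [h10] at key
    exact ⟨by linarith, fun h => by linarith⟩
  · exact ⟨by rw [heq], fun _ => Or.inl heq⟩
  · have h8 := h3.resolve_left (by omega)
    have h9 := mul_nonneg hL.le (show 0 ≤ y - f - 1 by omega)
    refine ⟨?_, fun h => Or.inr ?_⟩
    · have := mul_nonneg (show 0 ≤ y - f by omega)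
        (show 0 ≤ L * (y - f - 1) + 2 * (L * f + ε - θ) by linarith)
      linarith
    · rw [h, sub_self] at key
      have h10 := (mul_eq_zero.1 key.symm).resolve_left (by omega)
      have h11 : L * (y - f - 1) = 0 := by linarith
      have h12 := (mul_eq_zero.1 h11).resolve_left hL.ne'
      have h13 : L * f + ε = θ := by linarith
      by_contra hne
      have h14 : stepHeight L ε lo hi (θ + 1) = f := by omega
      rw [h14] at h5
      rcases h5 with h5 | h5 <;> omega

/-- A discrete intermediate value principle; `F` need not be monotone. -/
theorem exists_crossing (F : ℤ → ℝ) (y : ℝ) (a : ℤ) (n : ℕ) (h0 : F a ≤ y)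
    (h1 : y ≤ F (a + (n + 1))) : ∃ k : ℤ, a ≤ k ∧ k ≤ a + n ∧ F k ≤ y ∧ y ≤ F (k + 1) := by
  induction n with
  | zero => exact ⟨a, le_rfl, by simp, h0, by simpa using h1⟩
  | succ n ih =>
    by_cases h : y ≤ F (a + (n + 1))
    · obtain ⟨k, h2, h3, h4⟩ := ih h
      exact ⟨k, h2, by push_cast; omega, h4⟩
    · exact ⟨a + (n + 1), by omega, by push_cast; omega, (not_le.1 h).le,
        by rw [add_assoc]; exact_mod_cast h1⟩

end Staircase

/-! ### Bundles of lattice segments over a unimodular triangulation -/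

/-- A convex set `P` whose integer points are the points `b + y e`, `b ∈ B`, `lo b ≤ y ≤ hi b`, where
the base configuration `B` has a regular unimodular triangulation with facets indexed by `D` and
heights `β`, over which the interpolations of `lo` and `hi` bound `P`. -/
structure SegmentBundle (N : ℕ) (P : Set (Fin N → ℝ)) where
  convex : Convex ℝ P
  e : Fin N → ℝ
  Y : (Fin N → ℝ) →ₗ[ℝ] ℝ
  B : Finset (Fin N → ℝ)
  lo : (Fin N → ℝ) → ℤ
  hi : (Fin N → ℝ) → ℤ
  β : (Fin N → ℝ) → ℝ
  D : Type
  [fintypeD : Fintype D]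
  κ : D → Type
  [fintypeκ : ∀ δ, Fintype (κ δ)]
  v : ∀ δ, κ δ → Fin N → ℝ
  μ : ∀ δ, κ δ → (Fin N → ℝ) →ᵃ[ℝ] ℝ
  Y_integral : Y.toAffineMap.IsIntegral
  Y_e : Y e = 1
  Y_base : ∀ b ∈ B, Y b = 0
  lo_le_hi : ∀ b ∈ B, lo b ≤ hi b
  mem_iff : ∀ x, x ∈ P ∩ integerPoints N ↔
    ∃ b ∈ B, ∃ y : ℤ, lo b ≤ y ∧ y ≤ hi b ∧ x = b + (y : ℝ) • e
  v_mem : ∀ δ i, v δ i ∈ B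
  μ_integral : ∀ δ i, (μ δ i).IsIntegral
  μ_self : ∀ δ i, μ δ i (v δ i) = 1
  μ_of_ne : ∀ δ i j, i ≠ j → μ δ i (v δ j) = 0
  μ_add : ∀ δ i x (t : ℝ), μ δ i (x + t • e) = μ δ i x
  β_lt : ∀ δ, ∀ b ∈ B, (∀ i, v δ i ≠ b) → ∑ i, μ δ i b * β (v δ i) < β b
  cover : ∀ x ∈ P, ∃ δ, (∀ i, 0 ≤ μ δ i x) ∧ ∑ i, μ δ i x = 1 ∧
    ∑ i, μ δ i x • v δ i + Y x • e = x ∧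
    ∑ i, μ δ i x * lo (v δ i) ≤ Y x ∧ Y x ≤ ∑ i, μ δ i x * hi (v δ i)

/-! ### Staircase cells over the base triangulation -/

namespace SegmentBundle

attribute [instance] fintypeD fintypeκ

variable {N : ℕ} {P : Set (Fin N → ℝ)} (S : SegmentBundle N P) (L : ℤ) (ε : (Fin N → ℝ) → ℤ)

/-- The height of the lower staircase of level `θ` over the base point `b`. -/
def f (θ : ℤ) (b : Fin N → ℝ) : ℤ := stepHeight L (ε b) (S.lo b) (S.hi b) θ

open Classical in
/-- The cell of level `θ` over a facet of the base. -/
noncomputable def cell (δ : S.D) (θ : ℤ) : Finset (Fin N → ℝ) :=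
  Finset.univ.image (fun i => S.v δ i + (S.f L ε θ (S.v δ i) : ℝ) • S.e) ∪
    Finset.univ.image (fun i => S.v δ i + (S.f L ε (θ + 1) (S.v δ i) : ℝ) • S.e)

/-- The lifting heights. -/
noncomputable def ω (M : ℝ) (x : Fin N → ℝ) : ℝ :=
  M * S.β (x - S.Y x • S.e) +
    (L * S.Y x * (S.Y x - 1) + 2 * ε (x - S.Y x • S.e) * S.Y x)

variable {L ε}

theorem mem_cell {δ : S.D} {θ : ℤ} {x : Fin N → ℝ} : x ∈ S.cell L ε δ θ ↔
    ∃ i, ∃ y : ℤ, (y = S.f L ε θ (S.v δ i) ∨ y = S.f L ε (θ + 1) (S.v δ i)) ∧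
      x = S.v δ i + (y : ℝ) • S.e := by
  simp only [cell, Finset.mem_union, Finset.mem_image, Finset.mem_univ, true_and]
  constructor
  · rintro (⟨i, rfl⟩ | ⟨i, rfl⟩)
    · exact ⟨i, _, Or.inl rfl, rfl⟩
    · exact ⟨i, _, Or.inr rfl, rfl⟩
  · rintro ⟨i, y, rfl | rfl, rfl⟩
    · exact Or.inl ⟨i, rfl⟩
    · exact Or.inr ⟨i, rfl⟩

theorem Y_add {b : Fin N → ℝ} (hb : b ∈ S.B) (y : ℝ) : S.Y (b + y • S.e) = y := by
  rw [map_add, map_smul, S.Y_base b hb, S.Y_e, smul_eq_mul, mul_one, zero_add]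

theorem ω_add (M : ℝ) {b : Fin N → ℝ} (hb : b ∈ S.B) (y : ℤ) :
    S.ω L ε M (b + (y : ℝ) • S.e) = M * S.β b + stepEnergy L (ε b) y := by
  rw [ω, S.Y_add hb, add_sub_cancel_right, stepEnergy]
  push_cast
  ring

theorem cell_subset (δ : S.D) (θ : ℤ) :
    (S.cell L ε δ θ : Set (Fin N → ℝ)) ⊆ P ∩ integerPoints N := by
  intro x hx
  obtain ⟨i, y, hy, rfl⟩ := S.mem_cell.1 (Finset.mem_coe.1 hx)
  have hle := S.lo_le_hi _ (S.v_mem δ i)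
  refine (S.mem_iff _).2 ⟨_, S.v_mem δ i, y, ?_, ?_, rfl⟩ <;> rcases hy with rfl | rfl
  · exact le_stepHeight
  · exact le_stepHeight
  · exact stepHeight_le hle
  · exact stepHeight_le hle

theorem μ_add_of_eq (δ : S.D) (i : S.κ δ) (y : ℝ) : S.μ δ i (S.v δ i + y • S.e) = 1 := by
  rw [S.μ_add, S.μ_self]

theorem μ_add_of_ne (δ : S.D) {i j : S.κ δ} (h : i ≠ j) (y : ℝ) :
    S.μ δ i (S.v δ j + y • S.e) = 0 := by
  rw [S.μ_add, S.μ_of_ne δ i j h]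

theorem sum_mul_μ (δ : S.D) (c : S.κ δ → ℝ) (j : S.κ δ) (y : ℝ) :
    ∑ i, c i * S.μ δ i (S.v δ j + y • S.e) = c j := by
  rw [Finset.sum_eq_single j, S.μ_add_of_eq, mul_one]
  · exact fun i _ hij => by rw [S.μ_add_of_ne δ hij, mul_zero]
  · exact fun h => absurd (Finset.mem_univ j) h

/-- The functional measuring the height above the lower staircase of level `θ`. -/
noncomputable def excess (L : ℤ) (ε : (Fin N → ℝ) → ℤ) (δ : S.D) (θ : ℤ) : (Fin N → ℝ) →ᵃ[ℝ] ℝ :=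
  S.Y.toAffineMap - ∑ i, (S.f L ε θ (S.v δ i) : ℝ) • S.μ δ i

theorem excess_apply (δ : S.D) (θ : ℤ) (x : Fin N → ℝ) :
    S.excess L ε δ θ x = S.Y x - ∑ i, (S.f L ε θ (S.v δ i) : ℝ) * S.μ δ i x := by
  change S.Y x - (∑ i, (S.f L ε θ (S.v δ i) : ℝ) • S.μ δ i) x = _
  rw [AffineMap.sum_apply_real]
  rfl

theorem excess_integral (δ : S.D) (θ : ℤ) : (S.excess L ε δ θ).IsIntegral := by
  intro x hx
  obtain ⟨z, hz⟩ := S.Y_integral x hx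
  choose c hc using fun i => S.μ_integral δ i x hx
  refine ⟨z - ∑ i, S.f L ε θ (S.v δ i) * c i, ?_⟩
  rw [excess_apply]
  change S.Y x = z at hz
  rw [hz]
  push_cast
  simp only [hc]

theorem excess_add (δ : S.D) (θ : ℤ) (j : S.κ δ) (y : ℝ) :
    S.excess L ε δ θ (S.v δ j + y • S.e) = y - S.f L ε θ (S.v δ j) := by
  rw [excess_apply, S.sum_mul_μ, S.Y_add (S.v_mem δ j)]

/-- At most one vertex of the facet is doubled in the cell. The excess over the lower staircase is
`1` at the upper copy of that vertex and `0` at all other points of the cell. It is dual to the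
upper copy; `μ δ i` minus it is dual to the lower copy, and `μ δ i` alone serves a vertex that is
not doubled. -/
theorem cell_hasIntegralDual (hL : 0 < L) (hε : Set.InjOn ε S.B)
    (hε' : ∀ b ∈ S.B, 0 ≤ ε b ∧ ε b < L) (δ : S.D) (θ : ℤ) :
    HasIntegralDual (S.cell L ε δ θ) := by
  have hstep : ∀ i, S.f L ε (θ + 1) (S.v δ i) ≠ S.f L ε θ (S.v δ i) →
      S.f L ε (θ + 1) (S.v δ i) = S.f L ε θ (S.v δ i) + 1 ∧
        L * S.f L ε θ (S.v δ i) + ε (S.v δ i) = θ := fun i hi =>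
    eq_of_stepHeight_succ_ne hL (S.lo_le_hi _ (S.v_mem δ i)) hi
  have huniq : ∀ i j, S.f L ε (θ + 1) (S.v δ i) ≠ S.f L ε θ (S.v δ i) →
      S.f L ε (θ + 1) (S.v δ j) ≠ S.f L ε θ (S.v δ j) → i = j := by
    intro i j hi hj
    have h1 := (hstep i hi).2
    have h2 := (hstep j hj).2
    obtain ⟨a1, a2⟩ := hε' _ (S.v_mem δ i)
    obtain ⟨b1, b2⟩ := hε' _ (S.v_mem δ j)
    -- Both labels are the residue of `θ` modulo `L`.
    have h3 : ε (S.v δ i) = ε (S.v δ j) := by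
      rw [← Int.emod_eq_of_lt a1 a2, ← Int.emod_eq_of_lt b1 b2,
        ← Int.mul_add_emod_self_left L (S.f L ε θ (S.v δ i)) (ε (S.v δ i)), h1, ← h2,
        Int.mul_add_emod_self_left]
    have h4 := hε (S.v_mem δ i) (S.v_mem δ j) h3
    by_contra hij
    have := S.μ_of_ne δ i j hij
    rw [← h4, S.μ_self] at this
    exact one_ne_zero this
  intro x hx
  obtain ⟨i, y, hy, rfl⟩ := S.mem_cell.1 hx
  by_cases hy0 : y = S.f L ε θ (S.v δ i)
  · by_cases hi : S.f L ε (θ + 1) (S.v δ i) = S.f L ε θ (S.v δ i)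
    · refine ⟨S.μ δ i, S.μ_integral δ i, S.μ_add_of_eq δ i _, fun w hw hne => ?_⟩
      obtain ⟨j, z, hz, rfl⟩ := S.mem_cell.1 hw
      refine S.μ_add_of_ne δ (fun hij => hne ?_) _
      subst hij
      have : z = y := by omega
      rw [this]
    · refine ⟨S.μ δ i - S.excess L ε δ θ, ?_, ?_, fun w hw hne => ?_⟩
      · intro p hp
        obtain ⟨a, ha⟩ := S.μ_integral δ i p hp
        obtain ⟨b, hb⟩ := S.excess_integral (L := L) (ε := ε) δ θ p hp
        exact ⟨a - b, by rw [AffineMap.coe_sub, Pi.sub_apply, ha, hb]; push_cast; rfl⟩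
      · rw [AffineMap.coe_sub, Pi.sub_apply, S.μ_add_of_eq, excess_add, hy0]
        simp
      · obtain ⟨j, z, hz, rfl⟩ := S.mem_cell.1 hw
        rw [AffineMap.coe_sub, Pi.sub_apply, excess_add]
        by_cases hij : i = j
        · subst hij
          have hz' : z = S.f L ε θ (S.v δ i) + 1 := by
            rcases hz with hz | hz
            · exact absurd (by rw [hz, hy0]) hne
            · rw [hz, (hstep i hi).1]
          rw [S.μ_add_of_eq, hz']
          push_cast
          ring
        · have hz' : z = S.f L ε θ (S.v δ j) := by
            rcases hz with hz | hz
            · exact hz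
            · by_contra h
              exact hij (huniq i j hi (hz ▸ h))
          rw [S.μ_add_of_ne δ hij, hz']
          simp
  · have hy1 := hy.resolve_left hy0
    have hi := hy1 ▸ hy0
    refine ⟨S.excess L ε δ θ, S.excess_integral δ θ, ?_, fun w hw hne => ?_⟩
    · rw [excess_add, hy1, (hstep i hi).1]
      push_cast
      ring
    · obtain ⟨j, z, hz, rfl⟩ := S.mem_cell.1 hw
      have hz' : z = S.f L ε θ (S.v δ j) := by
        rcases hz with hz | hz
        · exact hz
        · by_contra h
          have hij := huniq i j hi (hz ▸ h)
          subst hij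
          exact hne (by rw [hz, hy1])
      rw [excess_add, hz', sub_self]

/-- The affine function supporting the cell of level `θ`. -/
noncomputable def support (L : ℤ) (ε : (Fin N → ℝ) → ℤ) (M : ℝ) (δ : S.D) (θ : ℤ) :
    (Fin N → ℝ) →ᵃ[ℝ] ℝ :=
  (2 * θ : ℝ) • S.Y.toAffineMap + ∑ i, (M * S.β (S.v δ i) +
    ((stepEnergy L (ε (S.v δ i)) (S.f L ε θ (S.v δ i)) - 2 * θ * S.f L ε θ (S.v δ i) : ℤ) : ℝ)) •
      S.μ δ i

theorem support_apply (M : ℝ) (δ : S.D) (θ : ℤ) (x : Fin N → ℝ) :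
    S.support L ε M δ θ x = 2 * θ * S.Y x + ∑ i, (M * S.β (S.v δ i) +
    ((stepEnergy L (ε (S.v δ i)) (S.f L ε θ (S.v δ i)) - 2 * θ * S.f L ε θ (S.v δ i) : ℤ) : ℝ)) *
      S.μ δ i x := by
  change 2 * θ * S.Y x + (∑ i, _ • S.μ δ i : (Fin N → ℝ) →ᵃ[ℝ] ℝ) x = _
  rw [AffineMap.sum_apply_real]
  rfl

/-- The height factor `M` lifts the points over base vertices outside the facet above the
supporting function of level `θ`. -/
def IsLargeFactor (L : ℤ) (ε : (Fin N → ℝ) → ℤ) (M : ℝ) (δ : S.D) (θ : ℤ) : Prop :=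
  ∀ b ∈ S.B, ∀ y ∈ Finset.Icc (S.lo b) (S.hi b), (∀ i, S.v δ i ≠ b) →
    S.support L ε M δ θ (b + (y : ℝ) • S.e) < S.ω L ε M (b + (y : ℝ) • S.e)

/-- The difference of the two sides is affine in `M`, with slope the positive gap `β_lt` of the base
triangulation. Only finitely many facets, levels and points are involved. -/
theorem eventually_isLargeFactor (a b : ℤ) : ∀ᶠ M in Filter.atTop,
    ∀ δ, ∀ θ ∈ Finset.Icc a b, S.IsLargeFactor L ε M δ θ := by
  rw [Filter.eventually_all]
  intro δ
  rw [Filter.eventually_all_finset]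
  intro θ _
  unfold IsLargeFactor
  rw [Filter.eventually_all_finset]
  intro b hb
  rw [Filter.eventually_all_finset]
  intro y _
  by_cases hv : ∀ i, S.v δ i ≠ b
  · have hgap := sub_pos.2 (S.β_lt δ b hb hv)
    set c : S.κ δ → ℝ := fun i =>
      ((stepEnergy L (ε (S.v δ i)) (S.f L ε θ (S.v δ i)) - 2 * θ * S.f L ε θ (S.v δ i) : ℤ) : ℝ)
    filter_upwards [Filter.eventually_gt_atTop ((2 * θ * y + ∑ i, c i * S.μ δ i b -
      stepEnergy L (ε b) y) / (S.β b - ∑ i, S.μ δ i b * S.β (S.v δ i)))] with M hM _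
    rw [div_lt_iff₀ hgap] at hM
    rw [support_apply, ω_add S M hb, S.Y_add hb]
    simp only [S.μ_add, add_mul, Finset.sum_add_distrib]
    have : ∑ i, M * S.β (S.v δ i) * S.μ δ i b = M * ∑ i, S.μ δ i b * S.β (S.v δ i) := by
      rw [Finset.mul_sum]
      exact Finset.sum_congr rfl fun i _ => by ring
    rw [this]
    simp only [c] at hM
    linarith
  · exact Filter.Eventually.of_forall fun M h => absurd h hv

/-- Over a vertex of the facet, lifting minus support is the energy minus `2 * θ * y`, less its
minimum, and the minimizers are the two staircase heights. Over the other base points the factor `M`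
decides. -/
theorem cell_isLowerFace (hL : 0 < L) {M : ℝ} {δ : S.D} {θ : ℤ} (hM : S.IsLargeFactor L ε M δ θ) :
    IsLowerFace (P ∩ integerPoints N) (S.ω L ε M) (S.cell L ε δ θ) := by
  have hsup : ∀ i (y : ℤ), S.support L ε M δ θ (S.v δ i + (y : ℝ) • S.e) = 2 * θ * y +
      (M * S.β (S.v δ i) + ((stepEnergy L (ε (S.v δ i)) (S.f L ε θ (S.v δ i)) -
        2 * θ * S.f L ε θ (S.v δ i) : ℤ) : ℝ)) := fun i y => by
    rw [support_apply, S.sum_mul_μ, S.Y_add (S.v_mem δ i)]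
  refine ⟨S.cell_subset δ θ, S.support L ε M δ θ, fun x hx => ?_, fun x hx hxc => ?_⟩
  · obtain ⟨i, y, hy, rfl⟩ := S.mem_cell.1 hx
    rw [hsup, S.ω_add M (S.v_mem δ i)]
    by_cases hy0 : y = S.f L ε θ (S.v δ i)
    · rw [← hy0]
      push_cast
      ring
    · have hy1 := hy.resolve_left hy0
      obtain ⟨h1, h2⟩ : S.f L ε (θ + 1) (S.v δ i) = S.f L ε θ (S.v δ i) + 1 ∧
          L * S.f L ε θ (S.v δ i) + ε (S.v δ i) = θ :=
        eq_of_stepHeight_succ_ne hL (S.lo_le_hi _ (S.v_mem δ i)) fun h => hy0 (hy1.trans h)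
      rw [hy1, h1]
      generalize S.f L ε θ (S.v δ i) = f at *
      subst h2
      unfold stepEnergy
      push_cast
      ring
  · obtain ⟨b, hb, y, h1, h2, rfl⟩ := (S.mem_iff x).1 hx
    by_cases hv : ∀ i, S.v δ i ≠ b
    · exact hM b hb y (Finset.mem_Icc.2 ⟨h1, h2⟩) hv
    · push Not at hv
      obtain ⟨i, rfl⟩ := hv
      rw [hsup, S.ω_add M (S.v_mem δ i)]
      obtain ⟨h3, h4⟩ := stepEnergy_stepHeight_le (ε := ε (S.v δ i)) (θ := θ) hL h1 h2
      have h5 : stepEnergy L (ε (S.v δ i)) (S.f L ε θ (S.v δ i)) -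
          2 * θ * S.f L ε θ (S.v δ i) < stepEnergy L (ε (S.v δ i)) y - 2 * θ * y :=
        lt_of_le_of_ne h3 fun h => hxc (S.mem_cell.2 ⟨i, y, h4 h, rfl⟩)
      have h6 : ((stepEnergy L (ε (S.v δ i)) (S.f L ε θ (S.v δ i)) -
          2 * θ * S.f L ε θ (S.v δ i) : ℤ) : ℝ) <
            ((stepEnergy L (ε (S.v δ i)) y - 2 * θ * y : ℤ) : ℝ) := by exact_mod_cast h5
      have h7 : ((stepEnergy L (ε (S.v δ i)) y - 2 * θ * y : ℤ) : ℝ) =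
        stepEnergy L (ε (S.v δ i)) y - 2 * θ * y := by push_cast; ring
      rw [h7] at h6
      linarith

/-- The interpolated staircases run from the lower to the upper boundary over the base facet, so the
height of `x` falls between two consecutive ones. -/
theorem exists_mem_cell {a : ℤ} {n : ℕ} (ha : ∀ b ∈ S.B, S.f L ε a b = S.lo b)
    (hn : ∀ b ∈ S.B, S.f L ε (a + (n + 1)) b = S.hi b) {x : Fin N → ℝ} (hx : x ∈ P) :
    ∃ δ, ∃ θ ∈ Finset.Icc a (a + n),
      x ∈ convexHull ℝ (S.cell L ε δ θ : Set (Fin N → ℝ)) := by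
  obtain ⟨δ, hμ, hμ1, hμx, hlo, hhi⟩ := S.cover x hx
  obtain ⟨θ, h1, h2, h3, h4⟩ := exists_crossing
    (fun θ => ∑ i, S.μ δ i x * S.f L ε θ (S.v δ i)) (S.Y x) a n
    (by simpa only [ha _ (S.v_mem δ _)] using hlo) (by simpa only [hn _ (S.v_mem δ _)] using hhi)
  refine ⟨δ, θ, Finset.mem_Icc.2 ⟨h1, h2⟩, ?_⟩
  have hseg : S.Y x ∈ segment ℝ (∑ i, S.μ δ i x * S.f L ε θ (S.v δ i))
      (∑ i, S.μ δ i x * S.f L ε (θ + 1) (S.v δ i)) := by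
    rw [segment_eq_Icc (h3.trans h4)]
    exact ⟨h3, h4⟩
  obtain ⟨p, q, hp, hq, hpq, hY⟩ := hseg
  -- The same base coordinates are used on both staircases, and the weights `p`, `q` adjust the
  -- height.
  have hxe : x = ∑ i, S.μ δ i x • (p • (S.v δ i + (S.f L ε θ (S.v δ i) : ℝ) • S.e) +
      q • (S.v δ i + (S.f L ε (θ + 1) (S.v δ i) : ℝ) • S.e)) := by
    have e : ∀ i, S.μ δ i x • (p • (S.v δ i + (S.f L ε θ (S.v δ i) : ℝ) • S.e) +
        q • (S.v δ i + (S.f L ε (θ + 1) (S.v δ i) : ℝ) • S.e)) =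
        (p + q) • (S.μ δ i x • S.v δ i) + (p * (S.μ δ i x * S.f L ε θ (S.v δ i)) +
          q * (S.μ δ i x * S.f L ε (θ + 1) (S.v δ i))) • S.e := fun i => by module
    rw [Finset.sum_congr rfl fun i _ => e i, Finset.sum_add_distrib, ← Finset.smul_sum,
      ← Finset.sum_smul, Finset.sum_add_distrib, ← Finset.mul_sum, ← Finset.mul_sum, hpq, one_smul]
    simp only [smul_eq_mul] at hY
    rw [hY, hμx]
  have hmem : ∀ i, p • (S.v δ i + (S.f L ε θ (S.v δ i) : ℝ) • S.e) +
      q • (S.v δ i + (S.f L ε (θ + 1) (S.v δ i) : ℝ) • S.e) ∈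
        convexHull ℝ (S.cell L ε δ θ : Set (Fin N → ℝ)) := fun i =>
    (convex_convexHull ℝ _)
      (subset_convexHull ℝ _ (S.mem_cell.2 ⟨i, _, Or.inl rfl, rfl⟩))
      (subset_convexHull ℝ _ (S.mem_cell.2 ⟨i, _, Or.inr rfl, rfl⟩)) hp hq hpq
  have := (convex_convexHull ℝ (S.cell L ε δ θ : Set (Fin N → ℝ))).sum_mem
    (t := Finset.univ) (fun i _ => hμ i) hμ1 fun i _ => hmem i
  rwa [← hxe] at this

theorem finite_integerPoints (S : SegmentBundle N P) : (P ∩ integerPoints N).Finite := by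
  classical
  refine Set.Finite.subset (S.B.biUnion fun b => (Finset.Icc (S.lo b) (S.hi b)).image
    fun y : ℤ => b + (y : ℝ) • S.e).finite_toSet fun x hx => ?_
  obtain ⟨b, hb, y, h1, h2, rfl⟩ := (S.mem_iff x).1 hx
  simp only [Finset.coe_biUnion, Set.mem_iUnion, Finset.coe_image]
  exact ⟨b, hb, y, Finset.mem_coe.2 (Finset.mem_Icc.2 ⟨h1, h2⟩), rfl⟩

theorem exists_labels : ∃ (L : ℤ) (ε : (Fin N → ℝ) → ℤ), 0 < L ∧ Set.InjOn ε S.B ∧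
    ∀ b ∈ S.B, 0 ≤ ε b ∧ ε b < L := by
  classical
  -- The labels enumerate `B`; the extra `1` keeps `L` positive even for an empty base.
  refine ⟨S.B.card + 1, fun x => if h : x ∈ S.B then (S.B.equivFin ⟨x, h⟩ : ℕ) else 0,
    by positivity, fun x hx y hy hxy => ?_, fun b hb => ?_⟩
  · simp only [Finset.mem_coe] at hx hy
    simp only [hx, hy, dif_pos, Nat.cast_inj] at hxy
    exact congrArg Subtype.val (S.B.equivFin.injective (Fin.ext hxy))
  · simp only [hb, dif_pos]
    have := (S.B.equivFin ⟨b, hb⟩).2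
    omega

theorem exists_levels (hL : 0 < L) : ∃ (a : ℤ) (n : ℕ), (∀ b ∈ S.B, S.f L ε a b = S.lo b) ∧
    ∀ b ∈ S.B, S.f L ε (a + (n + 1)) b = S.hi b := by
  have h1 : ∀ᶠ a : ℤ in Filter.atBot, ∀ b ∈ S.B, a ≤ L * S.lo b + ε b :=
    (Filter.eventually_all_finset _).2 fun b _ => Filter.eventually_le_atBot _
  obtain ⟨a, ha⟩ := h1.exists
  have h2 : ∀ᶠ c : ℤ in Filter.atTop, ∀ b ∈ S.B, L * S.hi b + ε b < c :=
    (Filter.eventually_all_finset _).2 fun b _ => Filter.eventually_gt_atTop _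
  obtain ⟨c, hc, hca⟩ := (h2.and (Filter.eventually_gt_atTop a)).exists
  refine ⟨a, (c - a - 1).toNat, fun b hb => stepHeight_eq_lo hL (ha b hb), fun b hb => ?_⟩
  have : a + (((c - a - 1).toNat : ℤ) + 1) = c := by omega
  rw [this]
  exact stepHeight_eq_hi hL (S.lo_le_hi b hb) (hc b hb)

theorem hasRegularUnimodularTriangulation_and_isNormalPolytope (S : SegmentBundle N P) :
    HasRegularUnimodularTriangulation P ∧ IsNormalPolytope P := by
  obtain ⟨L, ε, hL, hε, hε'⟩ := S.exists_labels
  obtain ⟨a, n, ha, hn⟩ := S.exists_levels (ε := ε) hL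
  obtain ⟨M, hM⟩ := (S.eventually_isLargeFactor (L := L) (ε := ε) a (a + n)).exists
  set C : Set (Finset (Fin N → ℝ)) := {t | ∃ δ, ∃ θ ∈ Finset.Icc a (a + n), t = S.cell L ε δ θ}
  have hd : ∀ t ∈ C, HasIntegralDual t := by
    rintro _ ⟨δ, θ, -, rfl⟩
    exact S.cell_hasIntegralDual hL hε hε' δ θ
  have hcov : ∀ x ∈ P, ∃ t ∈ C, x ∈ convexHull ℝ (t : Set (Fin N → ℝ)) := fun x hx =>
    let ⟨δ, θ, hθ, h⟩ := S.exists_mem_cell ha hn hx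
    ⟨_, ⟨δ, θ, hθ, rfl⟩, h⟩
  refine ⟨hasRegularUnimodularTriangulation_of_cover S.convex S.finite_integerPoints
    (S.ω L ε M) ?_ hd hcov, isNormalPolytope_of_cover S.convex ?_ hd hcov⟩
  · rintro _ ⟨δ, θ, hθ, rfl⟩
    exact S.cell_isLowerFace hL (hM δ θ hθ)
  · rintro _ ⟨δ, θ, -, rfl⟩
    exact S.cell_subset δ θ

end SegmentBundle

/-! ### The facet as a bundle of lattice segments -/

section Facet

/-- The coordinates split into a first one, a last one, and a set of middle ones. -/
structure IsFrame {N : ℕ} (a z : Fin N) (J : Finset (Fin N)) : Prop where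
  first_notMem : a ∉ J
  last_notMem : z ∉ J
  ne : a ≠ z
  cases : ∀ i, i = a ∨ i = z ∨ i ∈ J

variable {N : ℕ}

/-- The sum of the unit vectors with index in `J`. -/
def middle (J : Finset (Fin N)) : Fin N → ℝ := fun i => if i ∈ J then 1 else 0

/-- The vertices of the polytope. -/
def frameVertices (h : ℕ) (a z : Fin N) (J : Finset (Fin N)) : Set (Fin N → ℝ) :=
  { 0,
    Pi.single z 1,
    middle J,
    (h : ℝ) • (middle J + Pi.single z 1),
    ((h : ℝ) - 1) • middle J + (h : ℝ) • Pi.single z 1,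
    (h : ℝ) • middle J + ((h : ℝ) - 1) • Pi.single z 1,
    Pi.single a 1 + (4 : ℝ) • Pi.single z 1,
    Pi.single a 1 + (5 : ℝ) • Pi.single z 1,
    Pi.single a 1 + middle J,
    Pi.single a 1 + middle J + Pi.single z 1 } ∪
  {x | ∃ i ∈ J, x = Pi.single i 1 ∨ x = Pi.single i 1 + Pi.single z 1}

/-- The face `x a = 0` of the polytope. -/
def frameFacet (h : ℕ) (a z : Fin N) (J : Finset (Fin N)) : Set (Fin N → ℝ) :=
  convexHull ℝ (frameVertices h a z J) ∩ {x | x a = 0}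

/-- The functional `α x_a + ζ x_z + γ x_j + σ ∑_{i ∈ J} x_i`. -/
noncomputable def frameFunctional (a z j : Fin N) (J : Finset (Fin N)) (α ζ γ σ : ℝ) :
    (Fin N → ℝ) →ₗ[ℝ] ℝ :=
  α • LinearMap.proj a + ζ • LinearMap.proj z + γ • LinearMap.proj j +
    σ • ∑ i ∈ J, LinearMap.proj i

theorem frameFunctional_apply (a z j : Fin N) (J : Finset (Fin N)) (α ζ γ σ : ℝ)
    (x : Fin N → ℝ) : frameFunctional a z j J α ζ γ σ x =
      α * x a + ζ * x z + γ * x j + σ * ∑ i ∈ J, x i := by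
  simp [frameFunctional]

theorem middle_of_mem {J : Finset (Fin N)} {i : Fin N} (hi : i ∈ J) : middle J i = 1 := if_pos hi

theorem middle_of_notMem {J : Finset (Fin N)} {i : Fin N} (hi : i ∉ J) : middle J i = 0 :=
  if_neg hi

theorem sum_middle (J : Finset (Fin N)) : ∑ i ∈ J, middle J i = J.card := by
  rw [Finset.sum_congr rfl fun i hi => middle_of_mem hi]
  simp

theorem sum_single_of_mem {J : Finset (Fin N)} {i : Fin N} (hi : i ∈ J) :
    ∑ k ∈ J, (Pi.single i 1 : Fin N → ℝ) k = 1 := by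
  simp [Pi.single_apply, hi]

theorem sum_single_of_notMem {J : Finset (Fin N)} {i : Fin N} (hi : i ∉ J) :
    ∑ k ∈ J, (Pi.single i 1 : Fin N → ℝ) k = 0 := by
  simp [Pi.single_apply, hi]

/-! ### Linear inequalities valid on the facet -/

namespace IsFrame

variable {a z : Fin N} {J : Finset (Fin N)} {h : ℕ}

/-- It suffices to test the vertices. The value at the middle vector is `γ + σ * J.card`; `h10` and
`h12` come from the unit vectors with index other than `j`, `h11` and `h13` from the one with index
`j`. -/
theorem le_of_mem_convexHull (F : IsFrame a z J) {j : Fin N} (hj : j ∈ J) {α ζ γ σ c : ℝ}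
    (h0 : 0 ≤ c) (h1 : ζ ≤ c) (h2 : γ + σ * J.card ≤ c) (h3 : h * (γ + σ * J.card + ζ) ≤ c)
    (h4 : (h - 1) * (γ + σ * J.card) + h * ζ ≤ c) (h5 : h * (γ + σ * J.card) + (h - 1) * ζ ≤ c)
    (h6 : α + 4 * ζ ≤ c) (h7 : α + 5 * ζ ≤ c) (h8 : α + (γ + σ * J.card) ≤ c)
    (h9 : α + (γ + σ * J.card) + ζ ≤ c) (h10 : σ ≤ c) (h11 : γ + σ ≤ c) (h12 : σ + ζ ≤ c)
    (h13 : γ + σ + ζ ≤ c) {x : Fin N → ℝ} (hx : x ∈ convexHull ℝ (frameVertices h a z J)) :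
    α * x a + ζ * x z + γ * x j + σ * ∑ i ∈ J, x i ≤ c := by
  set φ := frameFunctional a z j J α ζ γ σ with hφ
  rw [← frameFunctional_apply, ← hφ]
  have hja : j ≠ a := fun h => F.first_notMem (h ▸ hj)
  have hjz : j ≠ z := fun h => F.last_notMem (h ▸ hj)
  have ea : φ (Pi.single a 1) = α := by
    rw [hφ, frameFunctional_apply, sum_single_of_notMem F.first_notMem]
    simp [F.ne.symm, hja]
  have ez : φ (Pi.single z 1) = ζ := by
    rw [hφ, frameFunctional_apply, sum_single_of_notMem F.last_notMem]
    simp [F.ne, hjz]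
  have em : φ (middle J) = γ + σ * J.card := by
    rw [hφ, frameFunctional_apply, sum_middle, middle_of_mem hj, middle_of_notMem F.first_notMem,
      middle_of_notMem F.last_notMem]
    ring
  have ei : ∀ i ∈ J, φ (Pi.single i 1) = σ ∨ φ (Pi.single i 1) = γ + σ := fun i hi => by
    have hia : a ≠ i := fun h => F.first_notMem (h ▸ hi)
    have hiz : z ≠ i := fun h => F.last_notMem (h ▸ hi)
    rw [hφ, frameFunctional_apply, sum_single_of_mem hi]
    by_cases hij : j = i
    · right; simp [hia, hiz, hij]
    · left; simp [hia, hiz, hij]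
  refine convexHull_min (t := {x | φ x ≤ c}) ?_ (convex_halfSpace_le φ.isLinear c) hx
  rintro v (hv | ⟨i, hi, rfl | rfl⟩)
  · simp only [Set.mem_insert_iff, Set.mem_singleton_iff] at hv
    rw [Set.mem_ofPred_eq]
    rcases hv with rfl | rfl | rfl | rfl | rfl | rfl | rfl | rfl | rfl | rfl <;>
    simp only [map_add, map_smul, map_zero, ea, ez, em, smul_eq_mul] <;> assumption
  · rw [Set.mem_ofPred_eq]
    rcases ei i hi with e | e <;> rw [e] <;> assumption
  · rw [Set.mem_ofPred_eq, map_add, ez]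
    rcases ei i hi with e | e <;> rw [e] <;> assumption

/-- The facet is a slice of the whole polytope, so the vertices with `x a = 1` must be tested too.
Since `x a = 0` on the slice, the coefficient of `x a` is free, and `-4` or `-5` absorbs the points
`e_1 + 4 e_d` and `e_1 + 5 e_d`. With `x j` the least middle coordinate, the deviation `∑ i ∈ J, x i
- J.card * x j` is nonnegative; the first and fifth inequalities then bound the base, the others the
height `x z`. -/
theorem inequalities (F : IsFrame a z J) (hh : 1 ≤ h) {x : Fin N → ℝ}
    (hx : x ∈ frameFacet h a z J) {j : Fin N} (hj : j ∈ J) :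
    0 ≤ x j ∧ 0 ≤ x z ∧ x z ≤ x j + 1 ∧ x j + (∑ i ∈ J, x i - J.card * x j) ≤ x z + 1 ∧
      x j + h * (∑ i ∈ J, x i - J.card * x j) ≤ h ∧
      x z + (h - 1) * (∑ i ∈ J, x i - J.card * x j) ≤ h := by
  obtain ⟨hx, hxa⟩ := hx
  rw [Set.mem_ofPred_eq] at hxa
  have hh' : (1 : ℝ) ≤ h := by exact_mod_cast hh
  have hn : (1 : ℝ) ≤ J.card := by exact_mod_cast Finset.card_pos.2 ⟨j, hj⟩
  have hhn : (1 : ℝ) ≤ h * J.card := one_le_mul_of_one_le_of_one_le hh' hn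
  refine ⟨?_, ?_, ?_, ?_, ?_, ?_⟩
  · have := F.le_of_mem_convexHull hj (α := 0) (ζ := 0) (γ := -1) (σ := 0) (c := 0)
      (by linarith) (by linarith) (by linarith) (by linarith) (by linarith) (by linarith)
      (by linarith) (by linarith) (by linarith) (by linarith) (by linarith) (by linarith)
      (by linarith) (by linarith) hx
    linarith
  · have := F.le_of_mem_convexHull hj (α := 0) (ζ := -1) (γ := 0) (σ := 0) (c := 0)
      (by linarith) (by linarith) (by linarith) (by linarith) (by linarith) (by linarith)
      (by linarith) (by linarith) (by linarith) (by linarith) (by linarith) (by linarith)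
      (by linarith) (by linarith) hx
    linarith
  · have := F.le_of_mem_convexHull hj (α := -4) (ζ := 1) (γ := -1) (σ := 0) (c := 1)
      (by linarith) (by linarith) (by linarith) (by linarith) (by linarith) (by linarith)
      (by linarith) (by linarith) (by linarith) (by linarith) (by linarith) (by linarith)
      (by linarith) (by linarith) hx
    rw [hxa] at this
    linarith
  · have := F.le_of_mem_convexHull hj (α := 0) (ζ := -1) (γ := 1 - J.card) (σ := 1) (c := 1)
      (by linarith) (by linarith) (by linarith) (by linarith) (by linarith) (by linarith)
      (by linarith) (by linarith) (by linarith) (by linarith) (by linarith) (by linarith)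
      (by linarith) (by linarith) hx
    linarith
  · have := F.le_of_mem_convexHull hj (α := 0) (ζ := 0) (γ := 1 - h * J.card) (σ := h) (c := h)
      (by linarith) (by linarith) (by linarith) (by linarith) (by linarith) (by linarith)
      (by linarith) (by linarith) (by linarith) (by linarith) (by linarith) (by linarith)
      (by linarith) (by linarith) hx
    linarith
  · have h1 : 0 ≤ ((h : ℝ) - 1) * J.card := by nlinarith
    have := F.le_of_mem_convexHull hj (α := -5) (ζ := 1) (γ := -((h - 1) * J.card)) (σ := h - 1)
      (c := h)
      (by linarith) (by linarith) (by linarith) (by linarith) (by linarith) (by linarith)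
      (by linarith) (by linarith) (by linarith) (by linarith) (by linarith) (by linarith)
      (by linarith) (by linarith) hx
    rw [hxa] at this
    linarith

theorem eq_of_coords (F : IsFrame a z J) {x y : Fin N → ℝ} (ha : x a = y a) (hz : x z = y z)
    (hJ : ∀ i ∈ J, x i = y i) : x = y := by
  ext i
  rcases F.cases i with rfl | rfl | hi
  · exact ha
  · exact hz
  · exact hJ i hi

end IsFrame

/-- The base configuration: multiples of the middle vector, and its unit vectors if there are at
least two. -/
noncomputable def baseConfiguration (h : ℕ) (J : Finset (Fin N)) : Finset (Fin N → ℝ) :=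
  (Finset.range (h + 1)).image (fun k : ℕ => (k : ℝ) • middle J) ∪
    (J.filter fun _ => 2 ≤ J.card).image fun i => Pi.single i 1

theorem mem_baseConfiguration {h : ℕ} {J : Finset (Fin N)} {b : Fin N → ℝ} :
    b ∈ baseConfiguration h J ↔ (∃ k : ℕ, k ≤ h ∧ b = (k : ℝ) • middle J) ∨
      ∃ i ∈ J, 2 ≤ J.card ∧ b = Pi.single i 1 := by
  simp only [baseConfiguration, Finset.mem_union, Finset.mem_image, Finset.mem_range,
    Finset.mem_filter, Nat.lt_succ_iff]
  constructor
  · rintro (⟨k, hk, rfl⟩ | ⟨i, ⟨hi, hn⟩, rfl⟩)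
    · exact Or.inl ⟨k, hk, rfl⟩
    · exact Or.inr ⟨i, hi, hn, rfl⟩
  · rintro (⟨k, hk, rfl⟩ | ⟨i, hi, hn, rfl⟩)
    · exact Or.inl ⟨k, hk, rfl⟩
    · exact Or.inr ⟨i, ⟨hi, hn⟩, rfl⟩

open Classical in
/-- The value `p t` at `t • middle J`, and `c` at vectors whose middle coordinates differ. -/
noncomputable def byMultiple {α : Type*} (J : Finset (Fin N)) (j : Fin N) (p : ℤ → α) (c : α)
    (x : Fin N → ℝ) : α :=
  if ∀ i ∈ J, x i = x j then p ⌊x j⌋ else c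

theorem byMultiple_smul {α : Type*} {J : Finset (Fin N)} {j : Fin N} (hj : j ∈ J) (p : ℤ → α)
    (c : α) (k : ℕ) : byMultiple J j p c ((k : ℝ) • middle J) = p k := by
  rw [byMultiple, if_pos fun i hi => by simp [middle_of_mem hi, middle_of_mem hj]]
  simp [middle_of_mem hj]

theorem byMultiple_single {α : Type*} {J : Finset (Fin N)} {j i : Fin N} (hi : i ∈ J)
    (hn : 2 ≤ J.card) (p : ℤ → α) (c : α) : byMultiple J j p c (Pi.single i 1) = c := by
  rw [byMultiple, if_neg]
  intro H
  obtain ⟨k, hk, hki⟩ := Finset.exists_mem_ne hn i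
  have h1 := (H k hk).trans (H i hi).symm
  simp [hki] at h1

theorem Convex.add_smul_mem_of_le {C : Set (Fin N → ℝ)} (hC : Convex ℝ C) {p w : Fin N → ℝ}
    {c k : ℝ} (hp : p ∈ C) (hpc : p + c • w ∈ C) (h0 : 0 ≤ k) (hk : k ≤ c) : p + k • w ∈ C := by
  rcases eq_or_lt_of_le (h0.trans hk) with hc | hc
  · have : k = 0 := by linarith
    simpa [this] using hp
  · have := hC hp hpc (a := 1 - k / c) (b := k / c) (by
      rw [sub_nonneg, div_le_one hc]; exact hk) (by positivity) (by ring)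
    convert this using 1
    rw [smul_add, smul_smul, div_mul_cancel₀ k hc.ne', ← add_assoc, ← add_smul]
    simp

/-! ### Integer points of the facet -/

namespace IsFrame

variable {a z : Fin N} {J : Finset (Fin N)} {h : ℕ}

/-- These points lie on three segments of direction `middle J + Pi.single z 1`, one for each value
of `y - k`, whose ends are vertices. -/
theorem smul_middle_add_mem (h : ℕ) (a z : Fin N) (J : Finset (Fin N)) {k : ℕ} {y : ℤ}
    (hk : k ≤ h) (h1 : max ((k : ℤ) - 1) 0 ≤ y) (h2 : y ≤ min ((k : ℤ) + 1) h) :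
    (k : ℝ) • middle J + (y : ℝ) • (Pi.single z 1 : Fin N → ℝ) ∈
      convexHull ℝ (frameVertices h a z J) := by
  have hv : frameVertices h a z J ⊆ convexHull ℝ (frameVertices h a z J) := subset_convexHull ℝ _
  have hC := convex_convexHull ℝ (frameVertices h a z J)
  have hcases : y = k ∨ y = k + 1 ∨ y = k - 1 := by omega
  rcases hcases with rfl | rfl | rfl
  · have := hC.add_smul_mem_of_le (p := 0) (w := middle J + Pi.single z 1) (c := h) (k := k)
      (hv (by simp [frameVertices])) (hv (by simp [frameVertices])) (by positivity)
      (by exact_mod_cast hk)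
    convert this using 1
    push_cast
    module
  · have hk' : (k : ℝ) ≤ h - 1 := by
      have : (k : ℤ) + 1 ≤ h := by omega
      have : (k : ℝ) + 1 ≤ h := by exact_mod_cast this
      linarith
    have := hC.add_smul_mem_of_le (p := Pi.single z 1) (w := middle J + Pi.single z 1)
      (c := h - 1) (k := k) (hv (by simp [frameVertices])) (hv ?_) (by positivity) hk'
    · convert this using 1
      push_cast
      module
    · have e : (Pi.single z 1 + ((h : ℝ) - 1) • (middle J + Pi.single z 1) : Fin N → ℝ) =
        ((h : ℝ) - 1) • middle J + (h : ℝ) • Pi.single z 1 := by module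
      rw [e]
      simp [frameVertices]
  · have hk' : (k : ℝ) ≤ h := by exact_mod_cast hk
    have hk0 : (1 : ℝ) ≤ k := by
      have : 1 ≤ k := by omega
      exact_mod_cast this
    have := hC.add_smul_mem_of_le (p := middle J) (w := middle J + Pi.single z 1)
      (c := h - 1) (k := k - 1) (hv (by simp [frameVertices])) (hv ?_) (by linarith) (by linarith)
    · convert this using 1
      push_cast
      module
    · have e : (middle J + ((h : ℝ) - 1) • (middle J + Pi.single z 1) : Fin N → ℝ) =
        (h : ℝ) • middle J + ((h : ℝ) - 1) • Pi.single z 1 := by module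
      rw [e]
      simp [frameVertices]

theorem mem_facet_iff (F : IsFrame a z J) (hh : 1 ≤ h) {j₀ : Fin N} (hj₀ : j₀ ∈ J)
    (x : Fin N → ℝ) : x ∈ frameFacet h a z J ∩ integerPoints N ↔
      ∃ b ∈ baseConfiguration h J, ∃ y : ℤ, byMultiple J j₀ (fun t => max (t - 1) 0) 0 b ≤ y ∧
        y ≤ byMultiple J j₀ (fun t => min (t + 1) (h : ℤ)) 1 b ∧
        x = b + (y : ℝ) • Pi.single z 1 := by
  constructor
  · rintro ⟨hx, hxi⟩
    obtain ⟨j, hj, hmin⟩ := J.exists_min_image x ⟨j₀, hj₀⟩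
    obtain ⟨h1, h2, h3, h4, h5, h6⟩ := F.inequalities hh hx hj
    have hxa : x a = 0 := hx.2
    choose c hc using hxi
    have hr : ∀ i ∈ J, 0 ≤ c i - c j := fun i hi => by
      have := hmin i hi
      rw [hc, hc i] at this
      have : c j ≤ c i := by exact_mod_cast this
      omega
    have hs : ∑ i ∈ J, x i - J.card * x j = ((∑ i ∈ J, (c i - c j) : ℤ) : ℝ) := by
      push_cast
      rw [Finset.sum_sub_distrib, Finset.sum_const, nsmul_eq_mul]
      simp only [hc]
    rw [hs] at h4 h5 h6
    have hs0 : 0 ≤ ∑ i ∈ J, (c i - c j) := Finset.sum_nonneg hr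
    have hsingle : ∀ i ∈ J, c i - c j ≤ ∑ i ∈ J, (c i - c j) := fun i hi =>
      Finset.single_le_sum (f := fun i => c i - c j) hr hi
    rw [hc] at h1 h2 h4 h5 h6
    rw [hc, hc j] at h3
    rw [hc z] at h4
    generalize hS : ∑ i ∈ J, (c i - c j) = s at *
    have g1 : 0 ≤ c j := by exact_mod_cast h1
    have g2 : 0 ≤ c z := by exact_mod_cast h2
    have g3 : c z ≤ c j + 1 := by exact_mod_cast h3
    have g4 : c j + s ≤ c z + 1 := by exact_mod_cast h4
    have g5 : c j + h * s ≤ h := by exact_mod_cast h5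
    have g6 : c z + (h - 1) * s ≤ h := by exact_mod_cast h6
    have hh' : (1 : ℤ) ≤ h := by exact_mod_cast hh
    -- From `c j ≥ 0` the fifth inequality gives `h * s ≤ h`.
    have hs1 : s ≤ 1 := by nlinarith
    have hs01 : s = 0 ∨ s = 1 := by omega
    rcases hs01 with rfl | rfl
    · obtain ⟨k, hk⟩ := Int.eq_ofNat_of_zero_le g1
      refine ⟨(k : ℝ) • middle J, mem_baseConfiguration.2 (Or.inl ⟨k, by omega, rfl⟩), c z, ?_, ?_,
        F.eq_of_coords ?_ ?_ fun i hi => ?_⟩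
      · rw [byMultiple_smul hj₀]; omega
      · rw [byMultiple_smul hj₀]; omega
      · simp [hxa, middle_of_notMem F.first_notMem, F.ne]
      · simp [hc z, middle_of_notMem F.last_notMem]
      · have hiz : i ≠ z := fun h => F.last_notMem (h ▸ hi)
        have e1 := hr i hi
        have e2 := hsingle i hi
        have e3 : c i = k := by omega
        simp [hc i, middle_of_mem hi, hiz, e3]
    -- Deviation one forces `c j = 0`, and the nonnegative differences sum to one: a single middle
    -- coordinate is `1`. It is not the `j`-th, so there are at least two.
    · have hj0 : c j = 0 := by omega
      have hex : ∃ i ∈ J, c i ≠ 0 := by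
        by_contra! H
        rw [Finset.sum_eq_zero fun i hi => by rw [H i hi, hj0, sub_zero]] at hS
        exact zero_ne_one hS
      obtain ⟨i, hi, hci⟩ := hex
      have hij : i ≠ j := fun h => hci (h ▸ hj0)
      have hci1 : c i = 1 := by
        have := hr i hi
        have := hsingle i hi
        omega
      have hother : ∀ k ∈ J, k ≠ i → c k = 0 := fun k hk hki => by
        have e1 : (c i - c j) + (c k - c j) ≤ _ :=
          Finset.add_le_sum (f := fun i => c i - c j) hr hi hk hki.symm
        have e2 := hr k hk
        rw [hS] at e1
        omega
      have hn : 2 ≤ J.card := Finset.one_lt_card.2 ⟨i, hi, j, hj, hij⟩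
      refine ⟨Pi.single i 1, mem_baseConfiguration.2 (Or.inr ⟨i, hi, hn, rfl⟩), c z, ?_, ?_,
        F.eq_of_coords ?_ ?_ fun k hk => ?_⟩
      · rw [byMultiple_single hi hn]; exact g2
      · rw [byMultiple_single hi hn]; linarith
      · have hia : a ≠ i := fun h => F.first_notMem (h ▸ hi)
        simp [hxa, hia, F.ne]
      · have hiz : z ≠ i := fun h => F.last_notMem (h ▸ hi)
        simp [hc z, hiz]
      · have hkz : k ≠ z := fun h => F.last_notMem (h ▸ hk)
        by_cases hki : k = i
        · subst hki
          simp [hc k, hkz, hci1]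
        · simp [hc k, hkz, hki, hother k hk hki]
  · rintro ⟨b, hb, y, h1, h2, rfl⟩
    rcases mem_baseConfiguration.1 hb with ⟨k, hk, rfl⟩ | ⟨i, hi, hn, rfl⟩
    · rw [byMultiple_smul hj₀] at h1 h2
      refine ⟨⟨smul_middle_add_mem h a z J hk h1 h2, ?_⟩, fun i => ?_⟩
      · simp [middle_of_notMem F.first_notMem, F.ne]
      · rcases F.cases i with rfl | rfl | hi
        · exact ⟨0, by simp [middle_of_notMem F.first_notMem, F.ne]⟩
        · exact ⟨y, by simp [middle_of_notMem F.last_notMem]⟩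
        · have hiz : i ≠ z := fun h => F.last_notMem (h ▸ hi)
          exact ⟨k, by simp [middle_of_mem hi, hiz]⟩
    · rw [byMultiple_single hi hn] at h1 h2
      have hia : a ≠ i := fun h => F.first_notMem (h ▸ hi)
      refine ⟨⟨subset_convexHull ℝ _ (Or.inr ⟨i, hi, ?_⟩), ?_⟩, fun k => ?_⟩
      · have : y = 0 ∨ y = 1 := by omega
        rcases this with rfl | rfl
        · left; simp
        · right; simp
      · simp [hia, F.ne]
      · exact ⟨(Pi.single i 1 : Fin N → ℤ) k + y * (Pi.single z 1 : Fin N → ℤ) k, by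
          simp [Pi.single_apply]⟩

end IsFrame

end Facet

/-! ### The regular unimodular triangulation of the base -/

section FacetBundle

variable {N : ℕ} {a z : Fin N} {J : Finset (Fin N)} {h : ℕ}

/-- The vertices of a facet of the base triangulation: two consecutive multiples of the middle
vector and all unit vectors but one. -/
noncomputable def facetVertex (J : Finset (Fin N)) (k : ℕ) (j : Fin N) :
    Bool ⊕ {i // i ∈ J.erase j} → Fin N → ℝ
  | Sum.inl false => (k : ℝ) • middle J
  | Sum.inl true => ((k + 1 : ℕ) : ℝ) • middle J
  | Sum.inr i => Pi.single i.1 1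

/-- The barycentric coordinates of a facet of the base triangulation. -/
noncomputable def facetCoord (a z : Fin N) (J : Finset (Fin N)) (k : ℕ) (j : Fin N) :
    Bool ⊕ {i // i ∈ J.erase j} → (Fin N → ℝ) →ᵃ[ℝ] ℝ
  | Sum.inl false => AffineMap.const ℝ _ ((k : ℝ) + 1) +
      (frameFunctional a z j J 0 0 ((k + 1) * J.card - 1) (-(k + 1))).toAffineMap
  | Sum.inl true => AffineMap.const ℝ _ (-(k : ℝ)) +
      (frameFunctional a z j J 0 0 (1 - k * J.card) k).toAffineMap
  | Sum.inr i => (LinearMap.proj (R := ℝ) (φ := fun _ : Fin N => ℝ) i.1 -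
      LinearMap.proj j).toAffineMap

theorem facetCoord_false (k : ℕ) (j : Fin N) (x : Fin N → ℝ) :
    facetCoord a z J k j (Sum.inl false) x =
      (k + 1) * (1 - (∑ i ∈ J, x i - J.card * x j)) - x j := by
  change (k : ℝ) + 1 + frameFunctional a z j J 0 0 ((k + 1) * J.card - 1) (-(k + 1)) x = _
  rw [frameFunctional_apply]
  ring

theorem facetCoord_true (k : ℕ) (j : Fin N) (x : Fin N → ℝ) :
    facetCoord a z J k j (Sum.inl true) x =
      x j - k * (1 - (∑ i ∈ J, x i - J.card * x j)) := by
  change -(k : ℝ) + frameFunctional a z j J 0 0 (1 - k * J.card) k x = _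
  rw [frameFunctional_apply]
  ring

theorem facetCoord_inr (k : ℕ) (j : Fin N) (i : {i // i ∈ J.erase j}) (x : Fin N → ℝ) :
    facetCoord a z J k j (Sum.inr i) x = x i.1 - x j := rfl

/-- The deviation of `x` from a multiple of the middle vector vanishes on multiples. -/
theorem deviation_smul {j : Fin N} (hj : j ∈ J) (t : ℝ) :
    ∑ i ∈ J, (t • middle J) i - J.card * (t • middle J) j = 0 := by
  simp only [Pi.smul_apply, smul_eq_mul, ← Finset.mul_sum, sum_middle, middle_of_mem hj]
  ring

theorem deviation_single {i j : Fin N} (hi : i ∈ J) (hij : j ≠ i) :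
    ∑ k ∈ J, (Pi.single i 1 : Fin N → ℝ) k - J.card * (Pi.single i 1 : Fin N → ℝ) j = 1 := by
  rw [sum_single_of_mem hi]
  simp [hij]

theorem sum_facet (j : Fin N) (f : Bool ⊕ {i // i ∈ J.erase j} → ℝ) (g : Fin N → ℝ)
    (hg : ∀ i, f (Sum.inr i) = g i.1) :
    ∑ i, f i = f (Sum.inl false) + f (Sum.inl true) + ∑ i ∈ J.erase j, g i := by
  rw [Fintype.sum_sum_type, Fintype.sum_bool, add_comm (f (Sum.inl true)),
    ← Finset.sum_coe_sort (J.erase j) g]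
  simp only [hg]

theorem sum_erase_sub {j : Fin N} (x : Fin N → ℝ) :
    ∑ i ∈ J.erase j, (x i - x j) = ∑ i ∈ J, x i - J.card * x j := by
  rw [Finset.sum_erase _ (sub_self _), Finset.sum_sub_distrib, Finset.sum_const, nsmul_eq_mul]

theorem facetCoord_smul {j : Fin N} (hj : j ∈ J) (k : ℕ) (t : ℝ) :
    facetCoord a z J k j (Sum.inl false) (t • middle J) = k + 1 - t ∧
    facetCoord a z J k j (Sum.inl true) (t • middle J) = t - k ∧
    ∀ i, facetCoord a z J k j (Sum.inr i) (t • middle J) = 0 := by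
  refine ⟨?_, ?_, fun i => ?_⟩
  · rw [facetCoord_false, deviation_smul hj]
    simp [middle_of_mem hj]
  · rw [facetCoord_true, deviation_smul hj]
    simp [middle_of_mem hj]
  · rw [facetCoord_inr]
    simp [middle_of_mem hj, middle_of_mem (Finset.mem_of_mem_erase i.2)]

theorem facetCoord_facetVertex {j : Fin N} (hj : j ∈ J) (k : ℕ)
    (i i' : Bool ⊕ {i // i ∈ J.erase j}) :
    facetCoord a z J k j i (facetVertex J k j i') = if i = i' then 1 else 0 := by
  rcases i' with (_ | _) | i'
  · obtain ⟨h1, h2, h3⟩ := facetCoord_smul (a := a) (z := z) hj k k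
    rcases i with (_ | _) | i
    · simp [facetVertex, h1]
    · simp [facetVertex, h2]
    · simp [facetVertex, h3]
  · obtain ⟨h1, h2, h3⟩ := facetCoord_smul (a := a) (z := z) hj k ((k + 1 : ℕ) : ℝ)
    rcases i with (_ | _) | i
    · simp only [facetVertex, h1]; simp
    · simp only [facetVertex, h2]; simp
    · simp only [facetVertex, h3]; simp
  · have hi := Finset.mem_erase.1 i'.2
    rcases i with (_ | _) | i
    · rw [facetVertex, facetCoord_false, deviation_single hi.2 hi.1.symm]
      simp [hi.1.symm]
    · rw [facetVertex, facetCoord_true, deviation_single hi.2 hi.1.symm]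
      simp [hi.1.symm]
    · rw [facetVertex, facetCoord_inr, Pi.single_eq_of_ne hi.1.symm, sub_zero, Pi.single_apply]
      simp only [Sum.inr.injEq, Subtype.ext_iff]

theorem facetCoord_integral (k : ℕ) (j : Fin N) (i : Bool ⊕ {i // i ∈ J.erase j}) :
    (facetCoord a z J k j i).IsIntegral := by
  intro x hx
  choose c hc using hx
  rcases i with (_ | _) | i
  · exact ⟨(k + 1) * (1 - (∑ i ∈ J, c i - J.card * c j)) - c j, by
      rw [facetCoord_false]; push_cast; simp only [hc]⟩
  · exact ⟨c j - k * (1 - (∑ i ∈ J, c i - J.card * c j)), by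
      rw [facetCoord_true]; push_cast; simp only [hc]⟩
  · exact ⟨c i.1 - c j, by rw [facetCoord_inr, hc, hc j]; push_cast; rfl⟩

namespace IsFrame

theorem facetCoord_add (F : IsFrame a z J) {j : Fin N} (hj : j ∈ J) (k : ℕ)
    (i : Bool ⊕ {i // i ∈ J.erase j}) (x : Fin N → ℝ) (t : ℝ) :
    facetCoord a z J k j i (x + t • Pi.single z 1) = facetCoord a z J k j i x := by
  have hx : ∀ i ∈ J, (x + t • Pi.single z 1 : Fin N → ℝ) i = x i := fun i hi => by
    have hiz : i ≠ z := fun h => F.last_notMem (h ▸ hi)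
    simp [hiz]
  rcases i with (_ | _) | i
  · rw [facetCoord_false, facetCoord_false, Finset.sum_congr rfl hx, hx j hj]
  · rw [facetCoord_true, facetCoord_true, Finset.sum_congr rfl hx, hx j hj]
  · rw [facetCoord_inr, facetCoord_inr, hx j hj, hx _ (Finset.mem_of_mem_erase i.2)]

theorem sum_facetCoord_smul (F : IsFrame a z J) (j : Fin N) (k : ℕ) {x : Fin N → ℝ}
    (hxa : x a = 0) :
    ∑ i, facetCoord a z J k j i x • facetVertex J k j i + x z • Pi.single z 1 = x := by
  -- The two multiples of the middle vector together contribute `x j • middle J`, for every `k`.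
  have key : ∀ l, (∑ i, facetCoord a z J k j i x • facetVertex J k j i) l =
      x j * middle J l + ∑ i ∈ J.erase j, (x i - x j) * (Pi.single i 1 : Fin N → ℝ) l := fun l => by
    rw [Finset.sum_apply, sum_facet j _ (fun i => (x i - x j) * (Pi.single i 1 : Fin N → ℝ) l)
      fun i => rfl]
    simp only [Pi.smul_apply, facetCoord_false, facetCoord_true, facetVertex, smul_eq_mul]
    push_cast
    ring
  have hout : ∀ l, l ∉ J → ∑ i ∈ J.erase j, (x i - x j) * (Pi.single i 1 : Fin N → ℝ) l = 0 :=
    fun l hl => Finset.sum_eq_zero fun i hi => by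
      have hil : l ≠ i := fun h => hl (h ▸ Finset.mem_of_mem_erase hi)
      simp [hil]
  refine F.eq_of_coords ?_ ?_ fun l hl => ?_
  · rw [Pi.add_apply, key, hout a F.first_notMem, middle_of_notMem F.first_notMem]
    simp [hxa, F.ne]
  · rw [Pi.add_apply, key, hout z F.last_notMem, middle_of_notMem F.last_notMem]
    simp
  · have hlz : l ≠ z := fun h => F.last_notMem (h ▸ hl)
    have hsum : ∑ i ∈ J.erase j, (x i - x j) * (Pi.single i 1 : Fin N → ℝ) l = x l - x j := by
      rw [Finset.sum_erase _ (by rw [sub_self, zero_mul]),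
        Finset.sum_eq_single_of_mem l hl fun i _ hi => by simp [hi.symm]]
      simp
    rw [Pi.add_apply, key, hsum, middle_of_mem hl]
    simp [hlz]

/-- Along the multiples the gap is that of the parabola above its chord, `(l - k) * (l - k - 1)`.
The only unit vector outside the facet is the omitted one, where the gap is `n * (k ^ 2 + k + 1) -
(2 * k + 1)` with `n = J.card ≥ 2`. -/
theorem base_strictConvex {j₀ : Fin N} (hj₀ : j₀ ∈ J) {k : ℕ} {j : Fin N} (hj : j ∈ J)
    {b : Fin N → ℝ} (hb : b ∈ baseConfiguration h J) (hne : ∀ i, facetVertex J k j i ≠ b) :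
    ∑ i, facetCoord a z J k j i b * byMultiple J j₀ (fun t => (t : ℝ) ^ 2) 1 (facetVertex J k j i)
      < byMultiple J j₀ (fun t => (t : ℝ) ^ 2) 1 b := by
  rw [sum_facet j _ (fun i => b i - b j) fun i => by
    have hi := Finset.mem_erase.1 i.2
    rw [facetCoord_inr, facetVertex,
      byMultiple_single hi.2 (Finset.one_lt_card.2 ⟨_, hi.2, j, hj, hi.1⟩), mul_one],
    sum_erase_sub, facetVertex, facetVertex, byMultiple_smul hj₀, byMultiple_smul hj₀]
  rcases mem_baseConfiguration.1 hb with ⟨l, hl, rfl⟩ | ⟨i, hi, hn, rfl⟩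
  · obtain ⟨h1, h2, -⟩ := facetCoord_smul (a := a) (z := z) hj k l
    rw [h1, h2, deviation_smul hj, byMultiple_smul hj₀]
    have n1 : l ≠ k := fun e => hne (Sum.inl false) (by rw [e]; rfl)
    have n2 : l ≠ k + 1 := fun e => hne (Sum.inl true) (by rw [e]; rfl)
    have hpos : 0 < ((l : ℤ) - k) * ((l : ℤ) - k - 1) := by
      rcases lt_or_gt_of_ne n1 with e | e
      · exact mul_pos_of_neg_of_neg (by omega) (by omega)
      · exact mul_pos (by omega) (by omega)
    have hpos' : (0 : ℝ) < ((l : ℝ) - k) * ((l : ℝ) - k - 1) := by exact_mod_cast hpos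
    push_cast
    nlinarith
  · have hij : i = j := by
      by_contra hij
      exact hne (Sum.inr ⟨i, Finset.mem_erase.2 ⟨hij, hi⟩⟩) rfl
    subst hij
    rw [facetCoord_false, facetCoord_true, sum_single_of_mem hi, byMultiple_single hi hn]
    have hn' : (2 : ℝ) ≤ J.card := by exact_mod_cast hn
    have hk : (0 : ℝ) ≤ k := Nat.cast_nonneg k
    have hprod := mul_le_mul_of_nonneg_right hn' (show (0 : ℝ) ≤ k * (k + 1) by positivity)
    simp only [Pi.single_eq_same]
    push_cast
    nlinarith [sq_nonneg (k : ℝ)]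

theorem exists_cover (F : IsFrame a z J) (hh : 1 ≤ h) {j₀ : Fin N} (hj₀ : j₀ ∈ J) {x : Fin N → ℝ}
    (hx : x ∈ frameFacet h a z J) : ∃ k < h, ∃ j ∈ J,
      (∀ i, 0 ≤ facetCoord a z J k j i x) ∧ ∑ i, facetCoord a z J k j i x = 1 ∧
      ∑ i, facetCoord a z J k j i x • facetVertex J k j i + x z • Pi.single z 1 = x ∧
      ∑ i, facetCoord a z J k j i x *
        (byMultiple J j₀ (fun t => max (t - 1) 0) 0 (facetVertex J k j i) : ℤ) ≤ x z ∧
      x z ≤ ∑ i, facetCoord a z J k j i x *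
        (byMultiple J j₀ (fun t => min (t + 1) (h : ℤ)) 1 (facetVertex J k j i) : ℤ) := by
  -- The omitted unit vector is one with the least middle coordinate, so that all differences `x i -
  -- x j` are nonnegative.
  obtain ⟨j, hj, hmin⟩ := J.exists_min_image x ⟨j₀, hj₀⟩
  obtain ⟨h1, h2, h3, h4, h5, h6⟩ := F.inequalities hh hx hj
  have hxa : x a = 0 := hx.2
  have hs0 : 0 ≤ ∑ i ∈ J, x i - J.card * x j := by
    rw [← sum_erase_sub]
    exact Finset.sum_nonneg fun i hi => sub_nonneg.2 (hmin i (Finset.mem_of_mem_erase hi))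
  have hinr : ∀ i : {i // i ∈ J.erase j}, i.1 ∈ J ∧ 2 ≤ J.card := fun i =>
    have hi := Finset.mem_erase.1 i.2
    ⟨hi.2, Finset.one_lt_card.2 ⟨_, hi.2, j, hj, hi.1⟩⟩
  -- With deviation `s`, the index `k` should satisfy `k ≤ x j / (1 - s) ≤ k + 1`; clearing the
  -- denominator also admits `s = 1`.
  obtain ⟨q, hq0, hq, hqle, hleq⟩ := exists_crossing
    (fun q => q * (1 - (∑ i ∈ J, x i - J.card * x j))) (x j) 0 (h - 1) (by simpa using h1) (by
      have : ((0 + (((h - 1 : ℕ) : ℤ) + 1) : ℤ) : ℝ) = h := by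
        have : (0 + (((h - 1 : ℕ) : ℤ) + 1) : ℤ) = h := by omega
        exact_mod_cast this
      rw [this]
      linarith)
  obtain ⟨k, rfl⟩ := Int.eq_ofNat_of_zero_le hq0
  push_cast at hqle hleq
  refine ⟨k, by omega, j, hj, ?_, ?_, F.sum_facetCoord_smul j k hxa, ?_, ?_⟩
  · rintro ((_ | _) | i)
    · rw [facetCoord_false]; linarith
    · rw [facetCoord_true]; linarith
    · rw [facetCoord_inr]; exact sub_nonneg.2 (hmin _ (hinr i).1)
  · rw [sum_facet j _ (fun i => x i - x j) fun i => rfl, sum_erase_sub, facetCoord_false,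
      facetCoord_true]
    ring
  · rw [sum_facet j _ (fun _ => 0) fun i => by
      rw [facetVertex, byMultiple_single (hinr i).1 (hinr i).2, Int.cast_zero, mul_zero],
      facetCoord_false, facetCoord_true, facetVertex, facetVertex, byMultiple_smul hj₀,
      byMultiple_smul hj₀, Finset.sum_const_zero, add_zero]
    -- For `k = 0` the lower bound is zero at every vertex. For `k ≥ 1` it is `t - 1` at `t • middle
    -- J`, and the interpolation is `x j - (1 - s)`.
    rcases Nat.eq_zero_or_pos k with rfl | hk
    · simpa using h2
    · rw [max_eq_left (by omega), max_eq_left (by omega)]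
      push_cast
      linarith
  · rw [sum_facet j _ (fun i => x i - x j) fun i => by
      rw [facetVertex, byMultiple_single (hinr i).1 (hinr i).2, Int.cast_one, mul_one,
        facetCoord_inr],
      sum_erase_sub, facetCoord_false, facetCoord_true, facetVertex, facetVertex,
      byMultiple_smul hj₀, byMultiple_smul hj₀, min_eq_left (show (k : ℤ) + 1 ≤ h by omega)]
    -- For `k + 1 < h` the upper bounds interpolate to `x j + 1`. In the last facet both multiples
    -- have upper bound `h`, and the result is `h * (1 - s) + s`.
    rcases lt_or_ge (k + 1) h with hk | hk
    · rw [min_eq_left (by omega)]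
      push_cast
      linarith
    · have hkh : (k : ℤ) + 1 = h := by omega
      rw [min_eq_right (by omega)]
      have hkh' : (k : ℝ) + 1 = h := by exact_mod_cast hkh
      push_cast
      rw [hkh']
      have : (k : ℝ) = h - 1 := by linarith
      rw [this]
      linarith

/-- The facet is a bundle of lattice segments. -/
noncomputable def segmentBundle (F : IsFrame a z J) (hh : 1 ≤ h) {j₀ : Fin N} (hj₀ : j₀ ∈ J) :
    SegmentBundle N (frameFacet h a z J) where
  convex := (convex_convexHull ℝ _).inter
    (convex_hyperplane (LinearMap.proj (R := ℝ) (φ := fun _ : Fin N => ℝ) a).isLinear 0)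
  e := Pi.single z 1
  Y := LinearMap.proj z
  B := baseConfiguration h J
  lo := byMultiple J j₀ (fun t => max (t - 1) 0) 0
  hi := byMultiple J j₀ (fun t => min (t + 1) (h : ℤ)) 1
  β := byMultiple J j₀ (fun t => (t : ℝ) ^ 2) 1
  D := Fin h × {j // j ∈ J}
  κ := fun δ => Bool ⊕ {i // i ∈ J.erase δ.2.1}
  v := fun δ => facetVertex J δ.1 δ.2
  μ := fun δ => facetCoord a z J δ.1 δ.2
  Y_integral := fun x hx => hx z
  Y_e := by simp
  Y_base := fun b hb => by
    rcases mem_baseConfiguration.1 hb with ⟨k, hk, rfl⟩ | ⟨i, hi, hn, rfl⟩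
    · simp [middle_of_notMem F.last_notMem]
    · have hiz : z ≠ i := fun h => F.last_notMem (h ▸ hi)
      simp [hiz]
  lo_le_hi := fun b hb => by
    rcases mem_baseConfiguration.1 hb with ⟨k, hk, rfl⟩ | ⟨i, hi, hn, rfl⟩
    · rw [byMultiple_smul hj₀, byMultiple_smul hj₀]
      omega
    · rw [byMultiple_single hi hn, byMultiple_single hi hn]
      exact zero_le_one
  mem_iff := F.mem_facet_iff hh hj₀
  v_mem := fun δ i => by
    have hk := δ.1.2
    rcases i with (_ | _) | i
    · exact mem_baseConfiguration.2 (Or.inl ⟨δ.1, by omega, rfl⟩)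
    · exact mem_baseConfiguration.2 (Or.inl ⟨δ.1 + 1, by omega, rfl⟩)
    · have hi := Finset.mem_erase.1 i.2
      exact mem_baseConfiguration.2 (Or.inr ⟨i.1, hi.2,
        Finset.one_lt_card.2 ⟨_, hi.2, δ.2.1, δ.2.2, hi.1⟩, rfl⟩)
  μ_integral := fun δ i => facetCoord_integral δ.1.1 δ.2.1 i
  μ_self := fun δ i => by rw [facetCoord_facetVertex δ.2.2, if_pos rfl]
  μ_of_ne := fun δ i j hij => by rw [facetCoord_facetVertex δ.2.2, if_neg hij]
  μ_add := fun δ i x t => F.facetCoord_add δ.2.2 δ.1 i x t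
  β_lt := fun δ _ hb hne => base_strictConvex hj₀ δ.2.2 hb hne
  cover := fun _ hx =>
    let ⟨k, hk, j, hj, hcov⟩ := F.exists_cover hh hj₀ hx
    ⟨⟨⟨k, hk⟩, ⟨j, hj⟩⟩, hcov⟩

end IsFrame

end FacetBundle

/-! ### The polytope in coordinates -/

theorem coordVec_eq_single {d : ℕ} (i : Fin d) : coordVec d (i + 1) = Pi.single i 1 := by
  ext j
  simp [coordVec, Pi.single_apply, Fin.ext_iff]

/-- The indices of the coordinates strictly between the first and the last one. -/
def middleIndices (d : ℕ) : Finset (Fin d) :=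
  Finset.univ.filter fun i => 1 ≤ (i : ℕ) ∧ (i : ℕ) + 1 < d

theorem mem_middleIndices {d : ℕ} {i : Fin d} :
    i ∈ middleIndices d ↔ 1 ≤ (i : ℕ) ∧ (i : ℕ) + 1 < d := by
  simp [middleIndices]

theorem middleVec_eq_middle (d : ℕ) : middleVec d = middle (middleIndices d) := by
  ext j
  simp only [middleVec, Finset.sum_apply, coordVec, Finset.sum_ite_eq, Finset.mem_Icc, middle,
    mem_middleIndices]
  congr 1
  apply propext
  omega

theorem facetZero_eq_frameFacet (h : ℕ) {d : ℕ} (hd : 3 ≤ d) :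
    facetZero h d = frameFacet h ⟨0, by omega⟩ ⟨d - 1, by omega⟩ (middleIndices d) := by
  have e1 : coordVec d 1 = Pi.single (⟨0, by omega⟩ : Fin d) 1 := coordVec_eq_single ⟨0, by omega⟩
  have e2 : coordVec d d = Pi.single (⟨d - 1, by omega⟩ : Fin d) 1 := by
    rw [← coordVec_eq_single]
    congr 1
    simp only
    omega
  have hv : vPoints d = {x | ∃ i ∈ middleIndices d, x = Pi.single i 1 ∨
      x = Pi.single i 1 + Pi.single (⟨d - 1, by omega⟩ : Fin d) 1} := by
    ext x
    constructor
    · rintro ⟨i, hi, hid, hx⟩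
      obtain ⟨k, rfl⟩ : ∃ k, i = k + 1 := ⟨i - 1, by omega⟩
      refine ⟨⟨k, by omega⟩, mem_middleIndices.2 ⟨by simp only; omega, by simp only; omega⟩, ?_⟩
      rwa [e2, coordVec_eq_single ⟨k, by omega⟩] at hx
    · rintro ⟨i, hi, hx⟩
      rw [mem_middleIndices] at hi
      refine ⟨i + 1, by omega, by omega, ?_⟩
      rwa [e2, coordVec_eq_single i]
  have hface : {x : Fin d → ℝ | ∀ j : Fin d, (j : ℕ) = 0 → x j = 0} =
      {x | x ⟨0, by omega⟩ = 0} := by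
    ext x
    exact ⟨fun hx => hx _ rfl, fun hx j hj => by
      rwa [show j = ⟨0, by omega⟩ from Fin.ext hj]⟩
  rw [facetZero, frameFacet, polytopeP, frameVertices, uPoints, hv, hface, e1, e2,
    middleVec_eq_middle]

theorem isFrame_middleIndices {d : ℕ} (hd : 3 ≤ d) :
    IsFrame (⟨0, by omega⟩ : Fin d) ⟨d - 1, by omega⟩ (middleIndices d) where
  first_notMem := by simp [mem_middleIndices]
  last_notMem := by rw [mem_middleIndices]; simp only; omega
  ne := by rw [ne_eq, Fin.ext_iff]; simp only; omega
  cases := fun i => by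
    rw [mem_middleIndices, Fin.ext_iff, Fin.ext_iff]
    simp only
    omega

theorem mainTheorem3 (h d : ℕ) (hh : 1 ≤ h) (hd : 3 ≤ d) :
    HasRegularUnimodularTriangulation (facetZero h d) ∧ IsNormalPolytope (facetZero h d) := by
  have hj : (⟨1, by omega⟩ : Fin d) ∈ middleIndices d :=
    mem_middleIndices.2 ⟨le_rfl, by simp only; omega⟩
  rw [facetZero_eq_frameFacet h hd]
  exact ((isFrame_middleIndices hd).segmentBundle hh
    hj).hasRegularUnimodularTriangulation_and_isNormalPolytope
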